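/- Let $\alpha\in[0,\pi]$. A treasure and an exit are placed at unknown points of the perimeter of a unit disk, at known arc distance $\alpha$ (for $\alpha=0$ the two points coincide). Two robots start at the centre of the disk, can move anywhere in the disk with speed at most $1$, and detect the exit or the treasure only when they are at its exact location. The first robot to reach the treasure picks it up and from then on carries it. The communication is face-to-face: two robots can exchange information (everything they have done and seen so far) only while they are at the same point. The robots' motions are prescribed by a deterministic online algorithm that may depend on $\alpha$: each robot's motion may depend only on what it has detected, on whether and when it met the other robot, and on what it was told then. Theorem (face-to-face upper bound). For every $\alpha\in[0,\pi]$ there is such an algorithm which, for every placement of the treasure and the exit on the perimeter at arc distance $\alpha$, brings the treasure to the exit at time at most $$1+\pi-\frac{\alpha}{2}+3\sin\frac{\alpha}{2}.$$ -/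

import Mathlib

open scoped NNReal

/-- A hidden placement of the exit and the treasure on the perimeter of the unit disk of the plane
`ℂ`, at arc distance `α` (for two points of the unit circle, the length of a shortest arc between
them is the unoriented angle between them). -/
structure Placement (α : ℝ) where
  exit : ℂ
  treasure : ℂ
  norm_exit : ‖exit‖ = 1
  norm_treasure : ‖treasure‖ = 1
  arc_dist : InnerProductGeometry.angle exit treasure = α

/-- A robot's trajectory, as a function of time: it starts at the centre, stays in the closed unit
disk and has speed at most `1`. -/
structure IsTrajectory (p : ℝ≥0 → ℂ) : Prop where
  start : p 0 = 0
  mem_disk : ∀ t, ‖p t‖ ≤ 1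
  speed : LipschitzWith 1 p

/-- When the treasure is hidden at `T` and the robots move along `p 0` and `p 1`, robot `i` holds
the treasure at time `t`. The robot that first reaches the treasure picks it up and keeps it. (If
both robots arrive simultaneously, robot `0` takes it; they are then at the same point with the same
information, so the choice is immaterial.) -/
def Holds (T : ℂ) (p : Fin 2 → ℝ≥0 → ℂ) (i : Fin 2) (t : ℝ≥0) : Prop :=
  ∃ s ≤ t, p i s = T ∧ (∀ r < s, ∀ j, p j r ≠ T) ∧ ∀ j < i, p j s ≠ T

/-- At time `t` the treasure is at the point `z`: either it is carried by a robot that is at `z`, or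
it is still at its hidden place, which no robot has visited so far. -/
def TreasureAt (T : ℂ) (p : Fin 2 → ℝ≥0 → ℂ) (t : ℝ≥0) (z : ℂ) : Prop :=
  (∃ i, Holds T p i t ∧ p i t = z) ∨ (z = T ∧ ∀ s ≤ t, ∀ j, p j s ≠ T)

/-- What robot `i` detects at time `t` at its own location is the same under the placement `ω` with
robot motions `p` as under the placement `ω'` with robot motions `p'`: the exit is detected in both
cases or in neither, and likewise the treasure. -/
def SameDetection {α : ℝ} (ω ω' : Placement α) (p p' : Fin 2 → ℝ≥0 → ℂ)
    (i : Fin 2) (t : ℝ≥0) : Prop :=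
  (p i t = ω.exit ↔ p' i t = ω'.exit) ∧
    (TreasureAt ω.treasure p t (p i t) ↔ TreasureAt ω'.treasure p' t (p' i t))

/-- Everything that robot `i` perceives at time `t` is the same in both executions: what it detects
at its location, which robots are there, and, by communication with any robot that is there, that
robot's whole past: its motion and its detections up to time `t`. (What that robot was told by robot
`i` at earlier meetings is known to robot `i` anyway.) -/
def SameObservation {α : ℝ} (ω ω' : Placement α) (p p' : Fin 2 → ℝ≥0 → ℂ)
    (i : Fin 2) (t : ℝ≥0) : Prop :=
  SameDetection ω ω' p p' i t ∧
    ∀ j, (p j t = p i t ↔ p' j t = p' i t) ∧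
      (p j t = p i t → ∀ r ≤ t, p j r = p' j r ∧ SameDetection ω ω' p p' j r)

/-- A (deterministic) two-robot algorithm in the face-to-face model, for known arc distance `α`.
It is described by the motion of the two robots under every placement. The robots do not know the
placement: the motions of a robot under two placements may separate only after the robot, having
moved identically so far, has made an observation that distinguishes the two executions. -/
structure F2FAlgorithm (α : ℝ) where
  pos : Placement α → Fin 2 → ℝ≥0 → ℂ
  isTrajectory : ∀ ω i, IsTrajectory (pos ω i)
  online : ∀ ω ω' i t, pos ω i t ≠ pos ω' i t →
    ∃ s < t, (∀ r ≤ s, pos ω i r = pos ω' i r) ∧ ¬ SameObservation ω ω' (pos ω) (pos ω') i s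

/-- Under the placement `ω`, the treasure has been brought to the exit at time `β` or before. -/
def F2FAlgorithm.EvacuatesBy {α : ℝ} (𝒜 : F2FAlgorithm α) (ω : Placement α) (β : ℝ) : Prop :=
  ∃ t : ℝ≥0, (t : ℝ) ≤ β ∧ ∃ i, Holds ω.treasure (𝒜.pos ω) i t ∧ 𝒜.pos ω i t = ω.exit

/-- Treasure-evacuation with two robots in the face-to-face model, for arc distance `α`, can be
solved in (worst-case) time `β`. -/
def SolvableF2F (α β : ℝ) : Prop :=
  ∃ 𝒜 : F2FAlgorithm α, ∀ ω : Placement α, 𝒜.EvacuatesBy ω β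

/-! Write `s = sin (α/2)` and count time from the arrival at the point `1`, from which the robots
search the circle in opposite senses. A robot that comes to the exit without the treasure flies
along chords to the two possible hiding places, the one ahead (cost `2s`) and then the one behind
(`2 sin α` more), and returns to the exit if it picks the treasure up there. A robot that picks up
the treasure at `T` during its search has two candidate exits, ahead and behind.

In the extremal situation the exit lies between the treasure and one of the robots. One robot
reaches the treasure by searching, at time `y`, the other by way of the exit, at time `2π - y - α +
2s`. These add up to `2π - α + 2s`, so the pickup happens by `π - α/2 + s`, and a last chord `2s`
gives the bound.

The difficulty is a carrier at `T` with `y < α`, for which the exit behind is not excluded by its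
own search. If the exit is behind, the other robot finds it at time `α - y` and, unless it finds the
treasure earlier, would fly into `T` at time `α - y + 2s + 2 sin α`. This time and `y` have mean `m
= α/2 + s + sin α`, which is `meetTime α` and does not depend on `y`. At time `m` the other robot
still has `m - y` to go to `T`, which is exactly how far a carrier moving towards it along the same
chord has come. The carrier therefore goes to that point of the chord and learns the side of the
exit from the presence or absence of the other robot. If `m < y`, an exit behind would have given
the treasure to the other robot, so the exit is ahead. If `y < m - 2 sin α`, the other robot would
not be on the chord yet, but then there is time to try both candidates. If `y = 0`, both robots are
at `T` and again both candidates are tried. The cost of the detour is controlled by convexity of the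
distance and `add_sin_add_abs_sin_le`.

The routes are written down with the placement known. `route_reach` and `route_ne_treasure` show
that `reach` is the time of the first visit to the treasure's place, hence who picks it up;
`route_eq_of_conveys` shows that every decision rests on an observation. -/

namespace TreasureHunt

/-! ### Trigonometric estimates -/

lemma sin_le_pi_sub {x : ℝ} (hx : x ≤ Real.pi) : Real.sin x ≤ Real.pi - x := by
  rw [← Real.sin_pi_sub]
  exact Real.sin_le (by linarith)

/-- The Taylor bounds hold only on `[-1, 1]`; doubling gives numerical bounds at the arguments
`1.14` and `1.26` needed below. -/
lemma sin_two_mul_le {x : ℝ} (h0 : 0 ≤ x) (h1 : x ≤ 1) :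
    Real.sin (2 * x) ≤ 2 * (x - x ^ 3 / 6 + x ^ 5 / 100) * (1 - x ^ 2 / 2 + x ^ 4 * (5 / 96)) := by
  have hx : |x| = x := abs_of_nonneg h0
  have hs := (abs_le.1 (Real.sin_bound (x := x) (by rwa [hx]))).2
  have hc := (abs_le.1 (Real.cos_bound (x := x) (by rwa [hx]))).2
  rw [hx] at hs hc
  have hs0 : 0 ≤ Real.sin x := Real.sin_nonneg_of_nonneg_of_le_pi h0 (by linarith [Real.pi_gt_three])
  have hc0 : 0 ≤ Real.cos x :=
    Real.cos_nonneg_of_neg_pi_div_two_le_of_le (by linarith [Real.pi_gt_three])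
      (by linarith [Real.pi_gt_three])
  rw [Real.sin_two_mul]
  have h := mul_le_mul (show Real.sin x ≤ x - x ^ 3 / 6 + x ^ 5 / 100 by linarith)
    (show Real.cos x ≤ 1 - x ^ 2 / 2 + x ^ 4 * (5 / 96) by linarith) hc0 (by linarith)
  nlinarith

lemma four_mul_sub_cube_le {s b : ℝ} (hb : 0 ≤ b) (hs : b ≤ s) (h : 1 / 6 ≤ b ^ 2) :
    4 * s - 8 * s ^ 3 ≤ 4 * b - 8 * b ^ 3 := by
  have h1 : 1 / 6 ≤ s * b := by nlinarith
  have h2 : 1 / 6 ≤ s ^ 2 := by nlinarith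
  nlinarith [mul_nonneg (sub_nonneg.2 hs) (show 0 ≤ s ^ 2 + s * b + b ^ 2 - 1 / 2 by linarith)]

lemma sub_cube_le_sin {b u : ℝ} (hb : 0 < b) (hu : b ≤ u) (hu' : u ≤ Real.pi / 2) :
    b - b ^ 3 / 6 ≤ Real.sin u :=
  (Real.sin_gt_sub_cube hb).le.trans
    (Real.sin_le_sin_of_le_of_le_pi_div_two (by linarith [Real.pi_pos]) hu' hu)

/-- Below `π/4` the part `2u + sin 2u` increases, while the cubic in `sin u` decreases once `sin u ≥
1/√6`. On short intervals the first is bounded at the right end and the second at the left end; the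
cuts keep the error below the small slack near `u = 0.57`. -/
lemma two_mul_add_sin_two_mul_le {u : ℝ} (h0 : 0 ≤ u) (h1 : u ≤ Real.pi / 2) :
    2 * u + Real.sin (2 * u) + (4 * Real.sin u - 8 * Real.sin u ^ 3) ≤ Real.pi := by
  have hpi := Real.pi_gt_d4
  have hpi' := Real.pi_lt_d4
  have hI := sin_le_pi_sub (x := 2 * u) (by linarith)
  have hs0 : 0 ≤ Real.sin u := Real.sin_nonneg_of_nonneg_of_le_pi h0 (by linarith)
  have mono : ∀ b, u ≤ b → b ≤ 3 / 4 → Real.sin (2 * u) ≤ Real.sin (2 * b) := fun b hb hb' =>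
    Real.sin_le_sin_of_le_of_le_pi_div_two (by linarith) (by linarith) (by linarith)
  rcases le_total u 0.57 with h | h
  · have hA := mono 0.57 h (by norm_num)
    have hB := sin_two_mul_le (x := 0.57) (by norm_num) (by norm_num)
    -- On `[0, ∞)` the cubic is largest at `1/√6 ≈ 0.408`, with value about `1.0887`; the hint is
    -- the factorization with a nearly double root there.
    have hC : 4 * Real.sin u - 8 * Real.sin u ^ 3 ≤ 1.089 := by
      nlinarith [mul_nonneg (show 0 ≤ Real.sin u + 0.816 by linarith)
        (sq_nonneg (Real.sin u - 0.408))]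
    norm_num at hA hB hC h ⊢
    linarith
  rcases le_total u 0.63 with h' | h'
  · have hA := mono 0.63 h' (by norm_num)
    have hB := sin_two_mul_le (x := 0.63) (by norm_num) (by norm_num)
    have hC := four_mul_sub_cube_le (by norm_num) (sub_cube_le_sin (by norm_num) h h1) (by norm_num)
    norm_num at hA hB hC h' ⊢
    linarith
  rcases le_total u 0.7 with h'' | h''
  · have hA := Real.sin_le_one (2 * u)
    have hC := four_mul_sub_cube_le (by norm_num) (sub_cube_le_sin (by norm_num) h' h1)
      (by norm_num)
    norm_num at hA hC h'' ⊢
    linarith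
  rcases le_total u (Real.pi / 4) with h3 | h3
  · have hA := Real.sin_le_one (2 * u)
    have hC := four_mul_sub_cube_le (by norm_num) (sub_cube_le_sin (by norm_num) h'' h1)
      (by norm_num)
    norm_num at hA hC ⊢
    linarith
  -- From `π/4` on, `sin² u ≥ 1/2` makes the cubic nonpositive, and `sin 2u ≤ π - 2u` is enough.
  · have hm := Real.sin_le_sin_of_le_of_le_pi_div_two (by linarith) h1 h3
    rw [Real.sin_pi_div_four] at hm
    have h2 : Real.sqrt 2 ^ 2 = 2 := Real.sq_sqrt (by norm_num)
    have hsq : 1 / 2 ≤ Real.sin u ^ 2 := by nlinarith [Real.sqrt_nonneg 2]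
    nlinarith

/-- This pays for the way from the meeting point to an exit ahead: `2 |sin (3a/2)|` is the distance
to that exit from the far end of the chord. The triple angle formula reduces the positive case to
`two_mul_add_sin_two_mul_le`; in the negative case `a + sin a ≤ π` and `sin³ ≤ sin` suffice. -/
lemma add_sin_add_abs_sin_le {a : ℝ} (h0 : 0 ≤ a) (h1 : a ≤ Real.pi) :
    a + Real.sin a + 2 * |Real.sin (3 * (a / 2))| ≤ Real.pi + 2 * Real.sin (a / 2) := by
  have hI := sin_le_pi_sub h1
  have hs0 : 0 ≤ Real.sin (a / 2) :=
    Real.sin_nonneg_of_nonneg_of_le_pi (by linarith) (by linarith)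
  have hs1 := Real.sin_le_one (a / 2)
  have h := two_mul_add_sin_two_mul_le (u := a / 2) (by linarith) (by linarith)
  rw [show 2 * (a / 2) = a by ring] at h
  rw [Real.sin_three_mul]
  rcases abs_cases (3 * Real.sin (a / 2) - 4 * Real.sin (a / 2) ^ 3) with ⟨e, _⟩ | ⟨e, _⟩
  · rw [e]; linarith
  · rw [e]
    have : Real.sin (a / 2) ^ 3 ≤ Real.sin (a / 2) := by
      nlinarith [mul_nonneg hs0 (mul_nonneg (sub_nonneg.2 hs1)
        (show 0 ≤ 1 + Real.sin (a / 2) by linarith))]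
    linarith

/-- Needed when the treasure is at the starting point `1` of the search and both candidate exits are
visited. -/
lemma two_mul_sin_le {a : ℝ} (h0 : 0 ≤ a) (h1 : a ≤ Real.pi) :
    2 * Real.sin a ≤ Real.pi - a / 2 + Real.sin (a / 2) := by
  have hs0 : 0 ≤ Real.sin (a / 2) :=
    Real.sin_nonneg_of_nonneg_of_le_pi (by linarith) (by linarith)
  have hI := sin_le_pi_sub h1
  have hpi := Real.pi_gt_three
  rcases le_total a 2 with h | h
  · linarith [Real.sin_le_one a]
  · linarith [Real.sin_le_one a]

/-! ### Directed angles on the unit circle -/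

/-- The point of the unit circle at directed angle `θ` from `1`, in the sense of rotation `ε`. -/
noncomputable def turn (ε θ : ℝ) : ℂ := Complex.exp ((ε * θ : ℝ) * Complex.I)

/-- The directed angle in `[0, 2π)` at which `z` is met when the circle is traversed from `1` in the
sense of rotation `ε`. -/
noncomputable def hit (ε : ℝ) (z : ℂ) : ℝ := toIcoMod Real.two_pi_pos 0 (ε * z.arg)

/-- `ε` is one of the two senses of rotation. -/
def IsSense (ε : ℝ) : Prop := ε = 1 ∨ ε = -1

lemma IsSense.neg {ε : ℝ} (hε : IsSense ε) : IsSense (-ε) := by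
  rcases hε with rfl | rfl
  · exact Or.inr rfl
  · exact Or.inl (neg_neg 1)

lemma turn_add (ε a b : ℝ) : turn ε (a + b) = turn ε a * turn ε b := by
  rw [turn, turn, turn, ← Complex.exp_add]
  push_cast
  ring_nf

lemma turn_zero (ε : ℝ) : turn ε 0 = 1 := by simp [turn]

lemma norm_turn (ε θ : ℝ) : ‖turn ε θ‖ = 1 := Complex.norm_exp_ofReal_mul_I _

lemma turn_neg (ε θ : ℝ) : turn (-ε) θ = turn ε (-θ) := by
  rw [turn, turn]; ring_nf

lemma turn_two_pi {ε : ℝ} (hε : IsSense ε) : turn ε (2 * Real.pi) = 1 := by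
  rcases hε with rfl | rfl
  · simp [turn]
  · rw [turn_neg, turn, Complex.exp_eq_one_iff]
    exact ⟨-1, by push_cast; ring⟩

lemma turn_mul_turn_neg (ε θ : ℝ) : turn ε θ * turn ε (-θ) = 1 := by
  rw [← turn_add, add_neg_cancel, turn_zero]

lemma hit_nonneg (ε : ℝ) (z : ℂ) : 0 ≤ hit ε z := (toIcoMod_mem_Ico Real.two_pi_pos 0 _).1

lemma hit_lt (ε : ℝ) (z : ℂ) : hit ε z < 2 * Real.pi := by
  simpa [hit] using (toIcoMod_mem_Ico Real.two_pi_pos 0 (ε * z.arg)).2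

lemma turn_hit {ε : ℝ} (hε : IsSense ε) {z : ℂ} (hz : ‖z‖ = 1) : turn ε (hit ε z) = z := by
  have h := Complex.norm_mul_exp_arg_mul_I z
  rw [hz, Complex.ofReal_one, one_mul] at h
  rw [hit, toIcoMod, turn]
  conv_rhs => rw [← h]
  rw [Complex.exp_eq_exp_iff_exists_int]
  rcases hε with rfl | rfl
  · exact ⟨-toIcoDiv Real.two_pi_pos 0 (1 * z.arg), by push_cast; simp; ring⟩
  · exact ⟨toIcoDiv Real.two_pi_pos 0 (-1 * z.arg), by push_cast; simp; ring⟩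

lemma turn_injOn {ε : ℝ} (hε : IsSense ε) {a b : ℝ} (ha : 0 ≤ a) (ha' : a < 2 * Real.pi)
    (hb : 0 ≤ b) (hb' : b < 2 * Real.pi) (h : turn ε a = turn ε b) : a = b := by
  obtain ⟨n, hn⟩ := Complex.exp_eq_exp_iff_exists_int.1 h
  have hn' : ε * a = ε * b + n * (2 * Real.pi) := by
    have := congrArg Complex.im hn
    simpa using this
  have key : ∀ m : ℤ, a = b + m * (2 * Real.pi) → a = b := by
    intro m hm
    have h1 : (-1 : ℝ) < m := by nlinarith [Real.pi_pos]
    have h2 : (m : ℝ) < 1 := by nlinarith [Real.pi_pos]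
    have : m = 0 := by
      have h1' : (-1 : ℤ) < m := by exact_mod_cast h1
      have h2' : m < 1 := by exact_mod_cast h2
      omega
    simpa [this] using hm
  rcases hε with rfl | rfl
  · exact key n (by linarith)
  · exact key (-n) (by push_cast; linarith)

lemma hit_eq {ε : ℝ} (hε : IsSense ε) {z : ℂ} {a : ℝ} (ha : 0 ≤ a) (ha' : a < 2 * Real.pi)
    (h : turn ε a = z) : hit ε z = a :=
  turn_injOn hε (hit_nonneg _ _) (hit_lt _ _) ha ha'
    (by rw [turn_hit hε (by rw [← h, norm_turn]), h])

lemma hit_neg_of_pos {ε : ℝ} (hε : IsSense ε) {z : ℂ} (hz : ‖z‖ = 1) (h : 0 < hit ε z) :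
    hit (-ε) z = 2 * Real.pi - hit ε z := by
  refine hit_eq hε.neg (by linarith [hit_lt ε z]) (by linarith) ?_
  rw [turn_neg, neg_sub, sub_eq_add_neg, turn_add, turn_hit hε hz, ← turn_neg, turn_two_pi hε.neg,
    mul_one]

lemma hit_neg_of_eq_zero {ε : ℝ} (hε : IsSense ε) {z : ℂ} (hz : ‖z‖ = 1) (h : hit ε z = 0) :
    hit (-ε) z = 0 := by
  refine hit_eq hε.neg le_rfl (by linarith [Real.pi_pos]) ?_
  rw [turn_neg, neg_zero, ← h, turn_hit hε hz]

lemma dist_mul_turn {ε : ℝ} (hε : IsSense ε) {z : ℂ} (hz : ‖z‖ = 1) (a b : ℝ) :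
    dist (z * turn ε a) (z * turn ε b) = 2 * |Real.sin ((a - b) / 2)| := by
  have h : z * turn ε a - z * turn ε b
      = z * turn ε b * (Complex.exp (Complex.I * (ε * (a - b) : ℝ)) - 1) := by
    have : turn ε a = turn ε b * Complex.exp (Complex.I * (ε * (a - b) : ℝ)) := by
      rw [mul_comm Complex.I, ← turn, ← turn_add]; ring_nf
    rw [this]; ring
  rw [dist_eq_norm, h, norm_mul, norm_mul, hz, norm_turn, Complex.norm_exp_I_mul_ofReal_sub_one]
  rcases hε with rfl | rfl
  · simp
  · rw [show -1 * (a - b) / 2 = -((a - b) / 2) by ring, Real.sin_neg]; simp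

lemma dist_turn_le {ε : ℝ} (hε : IsSense ε) (a b : ℝ) : dist (turn ε a) (turn ε b) ≤ |a - b| := by
  have h := dist_mul_turn hε (z := 1) (by simp) a b
  rw [one_mul, one_mul] at h
  rw [h]
  have := Real.abs_sin_le_abs (x := (a - b) / 2)
  rw [abs_div, abs_of_pos (show (0 : ℝ) < 2 by norm_num)] at this
  linarith

lemma treasure_eq {α : ℝ} (ω : Placement α) {ε : ℝ} (hε : IsSense ε) :
    ω.treasure = ω.exit * turn ε α ∨ ω.treasure = ω.exit * turn ε (-α) := by
  have hE : ω.exit ≠ 0 := norm_ne_zero_iff.1 (by rw [ω.norm_exit]; exact one_ne_zero)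
  have hT : ω.treasure ≠ 0 := norm_ne_zero_iff.1 (by rw [ω.norm_treasure]; exact one_ne_zero)
  have h := ω.arc_dist
  rw [InnerProductGeometry.angle_comm, Complex.angle_eq_abs_arg hT hE] at h
  have key := Complex.norm_mul_exp_arg_mul_I (ω.treasure / ω.exit)
  rw [norm_div, ω.norm_exit, ω.norm_treasure, div_one, Complex.ofReal_one, one_mul,
    eq_div_iff hE] at key
  have hturn : ∀ θ : ℝ, turn 1 θ = Complex.exp (θ * Complex.I) := fun θ => by rw [turn, one_mul]
  have key1 : ω.treasure = ω.exit * turn 1 α ∨ ω.treasure = ω.exit * turn 1 (-α) := by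
    rcases abs_choice (ω.treasure / ω.exit).arg with hh | hh
    · left
      rw [congrArg (turn 1) (h.symm.trans hh), hturn, mul_comm, key]
    · right
      rw [congrArg (turn 1) (neg_eq_iff_eq_neg.2 (h.symm.trans hh)), hturn, mul_comm, key]
  rcases hε with rfl | rfl
  · exact key1
  · rw [turn_neg, turn_neg, neg_neg]; exact key1.symm

/-! ### Polygonal walks at unit speed -/

/-- The motion from `a` to `b` at unit speed. -/
noncomputable def leg (a b : ℂ) (t : ℝ) : ℂ := AffineMap.lineMap a b (t / dist a b)

/-- The unit speed walk that starts at `a`, visits the listed points and stays at the last one. -/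
noncomputable def walk : ℂ → List ℂ → ℝ → ℂ
  | a, [], _ => a
  | a, b :: l, t => if t ≤ dist a b then leg a b t else walk b l (t - dist a b)

/-- A robot goes from the centre to `1`, follows the circle in the sense `ε` up to the directed
angle `x`, and then walks along the list `l` of stops. -/
noncomputable def patrol (ε x : ℝ) (l : List ℂ) (t : ℝ) : ℂ :=
  if t ≤ 1 then (t : ℂ)
  else if t ≤ 1 + x then turn ε (t - 1) else walk (turn ε x) l (t - (1 + x))

lemma leg_zero (a b : ℂ) : leg a b 0 = a := by simp [leg]

lemma leg_dist (a b : ℂ) : leg a b (dist a b) = b := by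
  rcases eq_or_ne a b with rfl | h
  · simp [leg]
  · rw [leg, div_self (dist_ne_zero.2 h), AffineMap.lineMap_apply_one]

lemma dist_leg_le (a b : ℂ) (s t : ℝ) : dist (leg a b s) (leg a b t) ≤ |s - t| := by
  rw [leg, leg, dist_lineMap_lineMap, Real.dist_eq, ← sub_div, abs_div, abs_of_nonneg dist_nonneg]
  rcases eq_or_ne (dist a b) 0 with h | h
  · simp [h]
  · rw [div_mul_cancel₀ _ h]

lemma leg_mem_segment (a b : ℂ) {t : ℝ} (h0 : 0 ≤ t) (h1 : t ≤ dist a b) :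
    leg a b t ∈ segment ℝ a b := by
  rw [segment_eq_image_lineMap]
  exact ⟨_, ⟨div_nonneg h0 dist_nonneg, div_le_one_of_le₀ h1 dist_nonneg⟩, rfl⟩

lemma norm_leg_le {a b : ℂ} (ha : ‖a‖ ≤ 1) (hb : ‖b‖ ≤ 1) {t : ℝ} (h0 : 0 ≤ t)
    (h1 : t ≤ dist a b) : ‖leg a b t‖ ≤ 1 := by
  have := (convex_closedBall (0 : ℂ) 1).segment_subset (by simpa using ha) (by simpa using hb)
    (leg_mem_segment a b h0 h1)
  simpa using this

/-- Lets the detour be estimated without knowing where on its chord the meeting point lies. -/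
lemma dist_leg_le_max (a b z : ℂ) {t : ℝ} (h0 : 0 ≤ t) (h1 : t ≤ dist a b) :
    dist (leg a b t) z ≤ max (dist a z) (dist b z) :=
  (convexOn_dist z convex_univ).le_max_of_mem_segment (Set.mem_univ a) (Set.mem_univ b)
    (leg_mem_segment a b h0 h1)

/-- By strict convexity of the disk the interior of a chord misses the circle, so nothing hidden is
met in the middle of a leg. -/
lemma leg_ne {a b z : ℂ} (ha : ‖a‖ ≤ 1) (hb : ‖b‖ ≤ 1) (hz : ‖z‖ = 1) (haz : a ≠ z) {t : ℝ}
    (h0 : 0 ≤ t) (h1 : t < dist a b) : leg a b t ≠ z := by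
  have hd : 0 < dist a b := h0.trans_lt h1
  rcases h0.eq_or_lt with rfl | h0
  · rwa [leg_zero]
  intro h
  have := norm_combo_lt_of_ne ha hb (dist_pos.1 hd) (sub_pos.2 ((div_lt_one hd).2 h1))
    (div_pos h0 hd) (by ring)
  rw [leg, AffineMap.lineMap_apply_module] at h
  rw [h, hz] at this
  exact lt_irrefl _ this

lemma leg_neg (a b : ℂ) (t : ℝ) : leg b a (dist a b - t) = leg a b t := by
  rcases eq_or_ne a b with rfl | h
  · simp [leg]
  · rw [leg, leg, ← AffineMap.lineMap_apply_one_sub, dist_comm b a, sub_div,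
      div_self (dist_ne_zero.2 h), sub_sub_cancel]

lemma walk_zero (a : ℂ) (l : List ℂ) : walk a l 0 = a := by
  cases l with
  | nil => rfl
  | cons b l => rw [walk, if_pos dist_nonneg, leg_zero]

lemma walk_of_le {a b : ℂ} {l : List ℂ} {t : ℝ} (h : t ≤ dist a b) :
    walk a (b :: l) t = leg a b t := if_pos h

lemma walk_of_ge {a b : ℂ} {l : List ℂ} {t : ℝ} (h : dist a b ≤ t) :
    walk a (b :: l) t = walk b l (t - dist a b) := by
  rcases h.eq_or_lt with rfl | h
  · rw [walk_of_le le_rfl, leg_dist, sub_self, walk_zero]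
  · exact if_neg h.not_ge

lemma dist_glue_le {f g : ℝ → ℂ} {c : ℝ} (hf : ∀ s t, dist (f s) (f t) ≤ |s - t|)
    (hg : ∀ s t, dist (g s) (g t) ≤ |s - t|) (hfg : f c = g c) (s t : ℝ) :
    dist (if s ≤ c then f s else g s) (if t ≤ c then f t else g t) ≤ |s - t| := by
  wlog h : s ≤ t generalizing s t
  · rw [dist_comm, abs_sub_comm]
    exact this t s (le_of_not_ge h)
  split_ifs with hs ht ht
  · exact hf s t
  · refine (dist_triangle _ (f c) _).trans ?_
    have h1 := hf s c
    have h2 := hg c t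
    rw [← hfg] at h2
    rw [abs_of_nonpos (by linarith)] at h1 h2 ⊢
    linarith
  · exact absurd (h.trans ht) hs
  · exact hg s t

lemma dist_walk_le (a : ℂ) (l : List ℂ) (s t : ℝ) : dist (walk a l s) (walk a l t) ≤ |s - t| := by
  induction l generalizing a s t with
  | nil => simp [walk]
  | cons b l ih =>
    exact dist_glue_le (f := leg a b) (g := fun t => walk b l (t - dist a b)) (dist_leg_le a b)
      (fun s t => (ih b _ _).trans_eq (by rw [sub_sub_sub_cancel_right]))
      (by rw [leg_dist, sub_self, walk_zero]) s t

lemma norm_walk_le {a : ℂ} {l : List ℂ} (ha : ‖a‖ ≤ 1) (hl : ∀ b ∈ l, ‖b‖ ≤ 1) {t : ℝ}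
    (ht : 0 ≤ t) : ‖walk a l t‖ ≤ 1 := by
  induction l generalizing a t with
  | nil => exact ha
  | cons b l ih =>
    have hb := hl b List.mem_cons_self
    rcases le_total t (dist a b) with h | h
    · rw [walk_of_le h]; exact norm_leg_le ha hb ht h
    · rw [walk_of_ge h]
      exact ih hb (fun c hc => hl c (List.mem_cons_of_mem b hc)) (sub_nonneg.2 h)

lemma patrol_of_le_one {ε x t : ℝ} {l : List ℂ} (h : t ≤ 1) : patrol ε x l t = t := if_pos h

lemma patrol_search {ε x t : ℝ} {l : List ℂ} (h : 1 ≤ t) (h' : t ≤ 1 + x) :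
    patrol ε x l t = turn ε (t - 1) := by
  rcases h.eq_or_lt with rfl | h
  · rw [patrol_of_le_one le_rfl, sub_self, turn_zero, Complex.ofReal_one]
  · rw [patrol, if_neg h.not_ge, if_pos h']

lemma patrol_walk {ε x t : ℝ} {l : List ℂ} (hx : 0 ≤ x) (h : 1 + x ≤ t) :
    patrol ε x l t = walk (turn ε x) l (t - (1 + x)) := by
  rcases h.eq_or_lt with rfl | h
  · rw [patrol_search (by linarith) le_rfl, sub_self, walk_zero, add_sub_cancel_left]
  · rw [patrol, if_neg (by linarith), if_neg h.not_ge]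

lemma dist_patrol_le {ε x : ℝ} (hε : IsSense ε) (hx : 0 ≤ x) (l : List ℂ) (s t : ℝ) :
    dist (patrol ε x l s) (patrol ε x l t) ≤ |s - t| := by
  refine dist_glue_le (f := fun t : ℝ => (t : ℂ)) (fun s t => ?_) (fun s t => dist_glue_le
    (f := fun t => turn ε (t - 1)) (g := fun t => walk (turn ε x) l (t - (1 + x)))
    (fun s t => ?_) (fun s t => ?_) ?_ s t) ?_ s t
  · rw [dist_eq_norm, ← Complex.ofReal_sub, Complex.norm_real, Real.norm_eq_abs]
  · exact (dist_turn_le hε _ _).trans_eq (by rw [sub_sub_sub_cancel_right])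
  · exact (dist_walk_le _ _ _ _).trans_eq (by rw [sub_sub_sub_cancel_right])
  · rw [sub_self, walk_zero, add_sub_cancel_left]
  · rw [if_pos (by linarith), sub_self, turn_zero, Complex.ofReal_one]

lemma norm_patrol_le {ε x : ℝ} (hx : 0 ≤ x) {l : List ℂ} (hl : ∀ b ∈ l, ‖b‖ ≤ 1) {t : ℝ}
    (ht : 0 ≤ t) : ‖patrol ε x l t‖ ≤ 1 := by
  rcases le_total t 1 with h | h
  · rw [patrol_of_le_one h, Complex.norm_real, Real.norm_eq_abs, abs_of_nonneg ht]
    exact h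
  rcases le_total t (1 + x) with h' | h'
  · rw [patrol_search h h', norm_turn]
  · rw [patrol_walk hx h']
    exact norm_walk_le (norm_turn ε x).le hl (sub_nonneg.2 h')

/-! ### The routes of the two robots -/

section Routes

variable {α : ℝ}

open Classical in
/-- The robot moving in the sense `ε`, if it does not find the treasure during its search, reaches
the exit, and then visits the two points at arc distance `α`, first the one ahead. This is the
time, counted from the arrival on the circle, at which it gets to the hiding place of the treasure
(provided that it does not leave the circle before for another reason). -/
noncomputable def reach (ε : ℝ) (ω : Placement α) : ℝ :=
  if hit ε ω.treasure < hit ε ω.exit then hit ε ω.treasure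
  else if ω.treasure = ω.exit * turn ε α then hit ε ω.exit + 2 * Real.sin (α / 2)
  else hit ε ω.exit + 2 * Real.sin (α / 2) + 2 * Real.sin α

/-- The treasure is still in place when the robot moving in the sense `ε` gets there. -/
def IsFirst (ε : ℝ) (ω : Placement α) : Prop := reach ε ω ≤ reach (-ε) ω

/-- The robot moving in the sense `ε` finds the treasure during its search, before the exit. -/
def Grabs (ε : ℝ) (ω : Placement α) : Prop := hit ε ω.treasure < hit ε ω.exit ∧ IsFirst ε ω

/-- The time, counted from the arrival on the circle, at which a robot that carries the treasure
checks whether the other robot has found the exit. -/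
noncomputable def meetTime (α : ℝ) : ℝ := α / 2 + Real.sin (α / 2) + Real.sin α

/-- The place where a robot that has found the treasure at `T` while moving in the sense `ε` checks
whether the other robot has found the exit: it is on the way of the other robot between the two
points at arc distance `α` from the possible exit behind. -/
noncomputable def meetPoint (α ε : ℝ) (T : ℂ) : ℂ :=
  leg T (T * turn ε (-(2 * α))) (meetTime α - hit ε T)

open Classical in
/-- The stops of a robot that has found the exit first. -/
noncomputable def fetchStops (ε : ℝ) (ω : Placement α) : List ℂ :=
  if ω.treasure = ω.exit * turn ε α ∧ IsFirst ε ω then [ω.exit * turn ε α, ω.exit]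
  else if ω.treasure = ω.exit * turn ε (-α) ∧ IsFirst ε ω then
    [ω.exit * turn ε α, ω.exit * turn ε (-α), ω.exit]
  else [ω.exit * turn ε α, ω.exit * turn ε (-α)]

/-- The exit is not behind, as the place there has been searched, or as the other robot would have
taken the treasure already. -/
def KnowsAhead (α ε : ℝ) (T : ℂ) : Prop := α ≤ hit ε T ∨ meetTime α < hit ε T

/-- There is no use in checking whether the other robot has found the exit. -/
def GoesAlone (α ε : ℝ) (T : ℂ) : Prop := hit ε T = 0 ∨ hit ε T + 2 * Real.sin α < meetTime α

open Classical in
/-- The stops of a robot that has found the treasure during its search. -/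
noncomputable def carryStops (ε : ℝ) (ω : Placement α) : List ℂ :=
  if KnowsAhead α ε ω.treasure then [ω.treasure * turn ε α]
  else if GoesAlone α ε ω.treasure then
    if ω.exit = ω.treasure * turn ε (-α) then [ω.treasure * turn ε (-α)]
    else [ω.treasure * turn ε (-α), ω.treasure * turn ε α]
  else if ω.exit = ω.treasure * turn ε (-α) then
    [meetPoint α ε ω.treasure, ω.treasure * turn ε (-α)]
  else [meetPoint α ε ω.treasure, ω.treasure * turn ε α]

open Classical in
/-- The directed angle at which the robot moving in the sense `ε` leaves the circle. -/
noncomputable def searchEnd (ε : ℝ) (ω : Placement α) : ℝ :=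
  if Grabs ε ω then hit ε ω.treasure else hit ε ω.exit

open Classical in
/-- The stops of the robot moving in the sense `ε` after its search. -/
noncomputable def stops (ε : ℝ) (ω : Placement α) : List ℂ :=
  if Grabs ε ω then carryStops ε ω else fetchStops ε ω

/-- The motion of the robot that searches the circle in the sense `ε`. -/
noncomputable def route (ε : ℝ) (ω : Placement α) : ℝ → ℂ :=
  patrol ε (searchEnd ε ω) (stops ε ω)

lemma norm_mul_turn {z : ℂ} (hz : ‖z‖ = 1) (ε θ : ℝ) : ‖z * turn ε θ‖ = 1 := by
  rw [norm_mul, hz, norm_turn, mul_one]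

lemma sin_half_nonneg (hα : α ∈ Set.Icc 0 Real.pi) : 0 ≤ Real.sin (α / 2) :=
  Real.sin_nonneg_of_nonneg_of_le_pi (by linarith [hα.1]) (by linarith [hα.1, hα.2])

lemma sin_nonneg (hα : α ∈ Set.Icc 0 Real.pi) : 0 ≤ Real.sin α :=
  Real.sin_nonneg_of_nonneg_of_le_pi hα.1 hα.2

lemma dist_turn_right (hα : α ∈ Set.Icc 0 Real.pi) {ε : ℝ} (hε : IsSense ε) {z : ℂ}
    (hz : ‖z‖ = 1) : dist z (z * turn ε α) = 2 * Real.sin (α / 2) := by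
  have h := dist_mul_turn hε hz 0 α
  rwa [turn_zero, mul_one, zero_sub, neg_div, Real.sin_neg, abs_neg,
    abs_of_nonneg (sin_half_nonneg hα)] at h

lemma dist_turn_neg_right (hα : α ∈ Set.Icc 0 Real.pi) {ε : ℝ} (hε : IsSense ε) {z : ℂ}
    (hz : ‖z‖ = 1) : dist z (z * turn ε (-α)) = 2 * Real.sin (α / 2) := by
  rw [← turn_neg]
  exact dist_turn_right hα hε.neg hz

lemma dist_turn_turn_neg (hα : α ∈ Set.Icc 0 Real.pi) {ε : ℝ} (hε : IsSense ε) {z : ℂ}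
    (hz : ‖z‖ = 1) : dist (z * turn ε α) (z * turn ε (-α)) = 2 * Real.sin α := by
  rw [dist_mul_turn hε hz, sub_neg_eq_add, add_self_div_two, abs_of_nonneg (sin_nonneg hα)]

/-- In the remaining case the meeting point really lies on the chord, since the distance prescribed
for it is between zero and the chord's length. -/
lemma dist_meetTime_bounds (hα : α ∈ Set.Icc 0 Real.pi) {ε : ℝ} (hε : IsSense ε) {T : ℂ}
    (hT : ‖T‖ = 1) (hA : ¬ KnowsAhead α ε T) (hG : ¬ GoesAlone α ε T) :
    dist T (T * turn ε (-(2 * α))) = 2 * Real.sin α ∧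
      0 ≤ meetTime α - hit ε T ∧ meetTime α - hit ε T ≤ 2 * Real.sin α := by
  rw [KnowsAhead, not_or, not_le, not_lt] at hA
  rw [GoesAlone, not_or, not_lt] at hG
  refine ⟨?_, by linarith [hA.2], by linarith [hG.2]⟩
  have h := dist_mul_turn hε hT 0 (-(2 * α))
  rwa [turn_zero, mul_one, zero_sub, neg_neg, mul_div_cancel_left₀ _ two_ne_zero,
    abs_of_nonneg (sin_nonneg hα)] at h

lemma norm_le_of_mem_stops (hα : α ∈ Set.Icc 0 Real.pi) {ε : ℝ} (hε : IsSense ε)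
    (ω : Placement α) : ∀ b ∈ stops ε ω, ‖b‖ ≤ 1 := by
  rw [stops]
  split_ifs
  · have h4 : ¬ KnowsAhead α ε ω.treasure → ¬ GoesAlone α ε ω.treasure →
        ‖meetPoint α ε ω.treasure‖ ≤ 1 := fun hA hG => by
      obtain ⟨hd, h0, h1⟩ := dist_meetTime_bounds hα hε ω.norm_treasure hA hG
      exact norm_leg_le ω.norm_treasure.le (norm_mul_turn ω.norm_treasure ε _).le h0 (h1.trans_eq hd.symm)
    rw [carryStops]
    split_ifs <;> simp [norm_turn, ω.norm_treasure] <;> exact h4 ‹_› ‹_›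
  · rw [fetchStops]
    split_ifs <;> simp [norm_turn, ω.norm_exit]

lemma searchEnd_nonneg (ε : ℝ) (ω : Placement α) : 0 ≤ searchEnd ε ω := by
  rw [searchEnd]; split_ifs <;> exact hit_nonneg _ _

lemma searchEnd_le (ε : ℝ) (ω : Placement α) : searchEnd ε ω ≤ hit ε ω.exit := by
  rw [searchEnd]
  split_ifs with h
  · exact h.1.le
  · exact le_rfl

lemma route_of_le_one {ε : ℝ} {ω : Placement α} {t : ℝ} (h : t ≤ 1) : route ε ω t = t :=
  patrol_of_le_one h

lemma route_search {ε : ℝ} {ω : Placement α} {t : ℝ} (h : 1 ≤ t) (h' : t ≤ 1 + searchEnd ε ω) :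
    route ε ω t = turn ε (t - 1) :=
  patrol_search h h'

lemma route_carry {ε : ℝ} (hε : IsSense ε) {ω : Placement α} (hg : Grabs ε ω) {t : ℝ}
    (h : 1 + hit ε ω.treasure ≤ t) :
    route ε ω t = walk ω.treasure (carryStops ε ω) (t - (1 + hit ε ω.treasure)) := by
  rw [route, searchEnd, stops, if_pos hg, if_pos hg, patrol_walk (hit_nonneg _ _) h,
    turn_hit hε ω.norm_treasure]

lemma route_fetch {ε : ℝ} (hε : IsSense ε) {ω : Placement α} (hg : ¬ Grabs ε ω) {t : ℝ}
    (h : 1 + hit ε ω.exit ≤ t) :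
    route ε ω t = walk ω.exit (fetchStops ε ω) (t - (1 + hit ε ω.exit)) := by
  rw [route, searchEnd, stops, if_neg hg, if_neg hg, patrol_walk (hit_nonneg _ _) h,
    turn_hit hε ω.norm_exit]

lemma exists_fetchStops_eq_cons (ε : ℝ) (ω : Placement α) :
    ∃ l, fetchStops ε ω = ω.exit * turn ε α :: l := by
  rw [fetchStops]; split_ifs <;> exact ⟨_, rfl⟩

lemma route_ahead (hα : α ∈ Set.Icc 0 Real.pi) {ε : ℝ} (hε : IsSense ε) {ω : Placement α}
    (hg : ¬ Grabs ε ω) {t : ℝ} (h : 1 + hit ε ω.exit ≤ t)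
    (h' : t ≤ 1 + (hit ε ω.exit + 2 * Real.sin (α / 2))) :
    route ε ω t = leg ω.exit (ω.exit * turn ε α) (t - (1 + hit ε ω.exit)) := by
  obtain ⟨l, hl⟩ := exists_fetchStops_eq_cons ε ω
  rw [route_fetch hε hg h, hl, walk_of_le]
  rw [dist_turn_right hα hε ω.norm_exit]
  linarith

lemma route_behind (hα : α ∈ Set.Icc 0 Real.pi) {ε : ℝ} (hε : IsSense ε) {ω : Placement α}
    (hg : ¬ Grabs ε ω) (hQ : ¬ (ω.treasure = ω.exit * turn ε α ∧ IsFirst ε ω)) {t : ℝ}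
    (h : 1 + (hit ε ω.exit + 2 * Real.sin (α / 2)) ≤ t)
    (h' : t ≤ 1 + (hit ε ω.exit + 2 * Real.sin (α / 2) + 2 * Real.sin α)) :
    route ε ω t = leg (ω.exit * turn ε α) (ω.exit * turn ε (-α))
      (t - (1 + (hit ε ω.exit + 2 * Real.sin (α / 2)))) := by
  have hs := sin_half_nonneg hα
  rw [route_fetch hε hg (by linarith), fetchStops, if_neg hQ]
  have hd := dist_turn_right hα hε ω.norm_exit
  have hd' := dist_turn_turn_neg hα hε ω.norm_exit
  split_ifs
  all_goals
    rw [walk_of_ge (by rw [hd]; linarith), walk_of_le (by rw [hd, hd']; linarith), hd]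
    congr 1
    ring

/-! ### The first visit to the treasure -/

lemma turn_add_two_pi {ε : ℝ} (hε : IsSense ε) (θ : ℝ) : turn ε (θ + 2 * Real.pi) = turn ε θ := by
  rw [turn_add, turn_two_pi hε, mul_one]

lemma hit_ahead (hα : α ∈ Set.Icc 0 Real.pi) {ε : ℝ} (hε : IsSense ε) {z w : ℂ} (hz : ‖z‖ = 1)
    (hw : w = z * turn ε α) :
    hit ε w = hit ε z + α ∧ hit ε z + α < 2 * Real.pi ∨
      hit ε w = hit ε z + α - 2 * Real.pi ∧ 2 * Real.pi ≤ hit ε z + α := by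
  have h0 := hit_nonneg ε z
  have h1 := hit_lt ε z
  have key : turn ε (hit ε z + α) = w := by rw [turn_add, turn_hit hε hz, hw]
  rcases lt_or_ge (hit ε z + α) (2 * Real.pi) with h | h
  · exact Or.inl ⟨hit_eq hε (by linarith [hα.1]) h key, h⟩
  · refine Or.inr ⟨hit_eq hε (by linarith) (by linarith [hα.2, Real.pi_pos]) ?_, h⟩
    rw [← turn_add_two_pi hε, sub_add_cancel, key]

lemma hit_behind (hα : α ∈ Set.Icc 0 Real.pi) {ε : ℝ} (hε : IsSense ε) {z w : ℂ} (hz : ‖z‖ = 1)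
    (hw : w = z * turn ε (-α)) :
    hit ε w = hit ε z - α ∧ α ≤ hit ε z ∨
      hit ε w = hit ε z - α + 2 * Real.pi ∧ hit ε z < α := by
  have h0 := hit_nonneg ε z
  have h1 := hit_lt ε z
  have key : turn ε (hit ε z - α) = w := by rw [sub_eq_add_neg, turn_add, turn_hit hε hz, hw]
  rcases le_or_gt α (hit ε z) with h | h
  · exact Or.inl ⟨hit_eq hε (by linarith) (by linarith [hα.1]) key, h⟩
  · refine Or.inr ⟨hit_eq hε (by linarith [hα.2, Real.pi_pos]) (by linarith) ?_, h⟩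
    rw [turn_add_two_pi hε, key]

lemma reach_of_lt {ε : ℝ} {ω : Placement α} (h : hit ε ω.treasure < hit ε ω.exit) :
    reach ε ω = hit ε ω.treasure := if_pos h

lemma reach_ahead {ε : ℝ} {ω : Placement α} (h : hit ε ω.exit ≤ hit ε ω.treasure)
    (hQ : ω.treasure = ω.exit * turn ε α) :
    reach ε ω = hit ε ω.exit + 2 * Real.sin (α / 2) := by
  rw [reach, if_neg h.not_gt, if_pos hQ]

lemma reach_behind {ε : ℝ} {ω : Placement α} (h : hit ε ω.exit ≤ hit ε ω.treasure)
    (hQ : ω.treasure ≠ ω.exit * turn ε α) :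
    reach ε ω = hit ε ω.exit + 2 * Real.sin (α / 2) + 2 * Real.sin α := by
  rw [reach, if_neg h.not_gt, if_neg hQ]

lemma reach_nonneg (hα : α ∈ Set.Icc 0 Real.pi) (ε : ℝ) (ω : Placement α) : 0 ≤ reach ε ω := by
  have h1 := sin_half_nonneg hα
  have h2 := sin_nonneg hα
  have h3 := hit_nonneg ε ω.treasure
  have h4 := hit_nonneg ε ω.exit
  rw [reach]; split_ifs <;> linarith

lemma not_grabs_of_le {ε : ℝ} {ω : Placement α} (h : hit ε ω.exit ≤ hit ε ω.treasure) :
    ¬ Grabs ε ω := fun hg => hg.1.not_ge h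

lemma hit_treasure_le_searchEnd {ε : ℝ} {ω : Placement α}
    (h : hit ε ω.treasure < hit ε ω.exit) : hit ε ω.treasure ≤ searchEnd ε ω := by
  rw [searchEnd]
  split_ifs
  exacts [le_rfl, h.le]

lemma searchEnd_of_not_grabs {ε : ℝ} {ω : Placement α} (h : ¬ Grabs ε ω) :
    searchEnd ε ω = hit ε ω.exit := if_neg h

lemma searchEnd_of_grabs {ε : ℝ} {ω : Placement α} (h : Grabs ε ω) :
    searchEnd ε ω = hit ε ω.treasure := if_pos h

lemma route_reach (hα : α ∈ Set.Icc 0 Real.pi) {ε : ℝ} (hε : IsSense ε) (ω : Placement α) :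
    route ε ω (1 + reach ε ω) = ω.treasure := by
  have h1 := sin_half_nonneg hα
  have h2 := sin_nonneg hα
  have h3 := hit_nonneg ε ω.treasure
  have h4 := hit_nonneg ε ω.exit
  rcases lt_or_ge (hit ε ω.treasure) (hit ε ω.exit) with h | h
  · rw [reach_of_lt h, route_search (by linarith) (by linarith [hit_treasure_le_searchEnd h]),
      add_sub_cancel_left, turn_hit hε ω.norm_treasure]
  have hg := not_grabs_of_le h
  by_cases hQ : ω.treasure = ω.exit * turn ε α
  · rw [reach_ahead h hQ, route_ahead hα hε hg (by linarith) le_rfl, ← add_assoc,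
      add_sub_cancel_left, ← dist_turn_right hα hε ω.norm_exit, leg_dist, hQ]
  · rw [reach_behind h hQ, route_behind hα hε hg (fun h => hQ h.1) (by linarith) le_rfl,
      ← add_assoc, add_sub_cancel_left, ← dist_turn_turn_neg hα hε ω.norm_exit, leg_dist]
    exact ((treasure_eq ω hε).resolve_left hQ).symm

/-- Before the time `reach` the route consists of the initial radius, an arc that ends too early,
and chords whose interiors avoid the circle. -/
lemma route_ne_treasure (hα : α ∈ Set.Icc 0 Real.pi) {ε : ℝ} (hε : IsSense ε) (ω : Placement α)
    {t : ℝ} (h0 : 0 ≤ t) (ht : t < 1 + reach ε ω) : route ε ω t ≠ ω.treasure := by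
  have h1 := sin_half_nonneg hα
  have h2 := sin_nonneg hα
  have h3 := hit_nonneg ε ω.treasure
  have h4 := hit_nonneg ε ω.exit
  rcases lt_or_ge t 1 with ht1 | ht1
  · rw [route_of_le_one ht1.le]
    intro h
    have := congrArg norm h
    rw [ω.norm_treasure, Complex.norm_real, Real.norm_eq_abs, abs_of_nonneg h0] at this
    exact ht1.ne this
  have search : ∀ s, 0 ≤ s → s < hit ε ω.treasure → turn ε s ≠ ω.treasure := fun s hs hs' h =>
    hs'.ne' (hit_eq hε hs (hs'.trans (hit_lt _ _)) h)
  rcases lt_or_ge (hit ε ω.treasure) (hit ε ω.exit) with h | h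
  · rw [reach_of_lt h] at ht
    rw [route_search ht1 (by linarith [hit_treasure_le_searchEnd h])]
    exact search _ (by linarith) (by linarith)
  have hg := not_grabs_of_le h
  rcases lt_or_ge t (1 + hit ε ω.exit) with hte | hte
  · rw [route_search ht1 (by rw [searchEnd_of_not_grabs hg]; exact hte.le)]
    exact search _ (by linarith) (by linarith)
  have hd := dist_turn_right hα hε ω.norm_exit
  -- The two points coincide only for `α = 0`, and then `reach` is the arrival at the exit, which is
  -- not later than `t`.
  have hET : ω.exit ≠ ω.treasure := by
    intro hET
    have ha := ω.arc_dist
    rw [hET, InnerProductGeometry.angle_self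
      (norm_ne_zero_iff.1 (by rw [ω.norm_treasure]; exact one_ne_zero))] at ha
    have hQ : ω.treasure = ω.exit * turn ε α := by
      rw [hET, show turn ε α = turn ε 0 from congrArg _ ha.symm, turn_zero, mul_one]
    have : Real.sin (α / 2) = 0 := by
      rw [show α / 2 = 0 by linarith, Real.sin_zero]
    rw [reach_ahead h hQ] at ht
    linarith
  have hE := ω.norm_exit.le
  have hX := fun θ => (norm_mul_turn ω.norm_exit ε θ).le
  by_cases hQ : ω.treasure = ω.exit * turn ε α
  · rw [reach_ahead h hQ] at ht
    rw [route_ahead hα hε hg hte ht.le]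
    exact leg_ne hE (hX _) ω.norm_treasure hET (by linarith) (by linarith)
  · rw [reach_behind h hQ] at ht
    rcases lt_or_ge t (1 + (hit ε ω.exit + 2 * Real.sin (α / 2))) with htc | htc
    · rw [route_ahead hα hε hg hte htc.le]
      exact leg_ne hE (hX _) ω.norm_treasure hET (by linarith) (by linarith)
    · rw [route_behind hα hε hg (fun h => hQ h.1) htc ht.le]
      exact leg_ne (hX _) (hX _) ω.norm_treasure (Ne.symm hQ) (by linarith)
        (by rw [dist_turn_turn_neg hα hε ω.norm_exit]; linarith)

/-- If the treasure is found by a robot during its search and the exit is behind, then the other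
robot is at the meeting point at the right time, and has been at the exit before. -/
lemma route_neg_meetTime (hα : α ∈ Set.Icc 0 Real.pi) {ε : ℝ} (hε : IsSense ε) {ω : Placement α}
    (hg : Grabs ε ω) (hA : ¬ KnowsAhead α ε ω.treasure) (hG : ¬ GoesAlone α ε ω.treasure)
    (hE : ω.exit = ω.treasure * turn ε (-α)) :
    route (-ε) ω (1 + meetTime α) = meetPoint α ε ω.treasure ∧
      ∃ r, 0 ≤ r ∧ r ≤ 1 + meetTime α ∧ route (-ε) ω r = ω.exit := by
  obtain ⟨hd, hK0, hK1⟩ := dist_meetTime_bounds hα hε ω.norm_treasure hA hG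
  have h1 := sin_half_nonneg hα
  have h2 := sin_nonneg hα
  rw [KnowsAhead, not_or, not_le, not_lt] at hA
  rw [GoesAlone, not_or, not_lt] at hG
  have hy : 0 < hit ε ω.treasure := (hit_nonneg _ _).lt_of_ne' hG.1
  have he : hit ε ω.exit = hit ε ω.treasure - α + 2 * Real.pi := by
    rcases hit_behind hα hε ω.norm_treasure hE with h | h
    · exact absurd h.2 hA.1.not_ge
    · exact h.1
  have hy' := hit_neg_of_pos hε ω.norm_treasure hy
  have he' := hit_neg_of_pos hε ω.norm_exit (by linarith [hit_nonneg ε ω.treasure, hg.1])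
  have hle : hit (-ε) ω.exit ≤ hit (-ε) ω.treasure := by linarith [hg.1]
  have hgn := not_grabs_of_le hle
  have hT : ω.treasure = ω.exit * turn (-ε) (-α) := by
    rw [hE, turn_neg, neg_neg, mul_assoc, mul_comm (turn ε (-α)), turn_mul_turn_neg, mul_one]
  have hY : ω.treasure * turn ε (-(2 * α)) = ω.exit * turn (-ε) α := by
    rw [hE, turn_neg, mul_assoc, ← turn_add]; ring_nf
  have hmt : meetTime α = α / 2 + Real.sin (α / 2) + Real.sin α := rfl
  refine ⟨?_, 1 + hit (-ε) ω.exit, by linarith [hit_nonneg (-ε) ω.exit], by linarith, ?_⟩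
  -- In the case of equality the meeting point is `T` and both robots reach it at the same time.
  -- This also disposes of `α = π`, where the places ahead and behind coincide and the chord
  -- degenerates.
  · rcases hA.2.eq_or_lt with heq | hlt
    · have hr : reach (-ε) ω ≤ meetTime α := by
        by_cases hQ : ω.treasure = ω.exit * turn (-ε) α
        · rw [reach_ahead hle hQ]; linarith
        · rw [reach_behind hle hQ]; linarith
      have hr' := hg.2
      rw [IsFirst, reach_of_lt hg.1, heq] at hr'
      rw [le_antisymm hr' hr, route_reach hα hε.neg, meetPoint, heq, sub_self, leg_zero]
    · have hsin : 0 < Real.sin α := by linarith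
      have hQ : ¬ (ω.treasure = ω.exit * turn (-ε) α ∧ IsFirst (-ε) ω) := by
        rintro ⟨hQ, -⟩
        rw [← hY] at hQ
        rw [← hQ, dist_self] at hd
        linarith
      rw [route_behind hα hε.neg hgn hQ (by linarith) (by linarith), meetPoint, hY, ← hT,
        ← leg_neg, dist_comm, ← hY, hd]
      congr 1
      linarith
  · rw [route_search (by linarith [hit_nonneg (-ε) ω.exit])
      (by rw [searchEnd_of_not_grabs hgn]), add_sub_cancel_left, turn_hit hε.neg ω.norm_exit]

end Routes

/-! ### The routes can be followed without knowing the placement -/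

section Online

variable {α : ℝ}

lemma dist_left_leg {a b : ℂ} {t : ℝ} (h0 : 0 ≤ t) (h1 : t ≤ dist a b) :
    dist a (leg a b t) = t := by
  rcases (dist_nonneg : 0 ≤ dist a b).eq_or_lt with h | h
  · rw [← h] at h1
    rw [le_antisymm h1 h0, leg_zero, dist_self]
  · rw [leg, dist_left_lineMap, Real.norm_eq_abs, abs_of_nonneg (by positivity),
      div_mul_cancel₀ _ h.ne']

/-- What the robot moving in the sense `ε` observes at time `s` under `ω`, and needs for its
decisions, is also observed under `ω'`. -/
structure Conveys (ε : ℝ) (ω ω' : Placement α) (s : ℝ) : Prop where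
  exit : route ε ω s = ω.exit → route ε ω' s = ω'.exit
  fresh : route ε ω s = ω.treasure → s ≤ 1 + reach ε ω → s ≤ 1 + reach (-ε) ω →
    route ε ω' s = ω'.treasure ∧ s ≤ 1 + reach ε ω' ∧ s ≤ 1 + reach (-ε) ω'
  told : route (-ε) ω s = route ε ω s →
    ∀ r, 0 ≤ r → r ≤ s → route (-ε) ω r = ω.exit → ω'.exit = ω.exit

lemma route_search_end_of_grabs {ε : ℝ} (hε : IsSense ε) {ω : Placement α} (hg : Grabs ε ω) :
    route ε ω (1 + hit ε ω.treasure) = ω.treasure := by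
  rw [route_search (by linarith [hit_nonneg ε ω.treasure]) (by rw [searchEnd_of_grabs hg]),
    add_sub_cancel_left, turn_hit hε ω.norm_treasure]

lemma route_search_end_of_not_grabs {ε : ℝ} (hε : IsSense ε) {ω : Placement α}
    (hg : ¬ Grabs ε ω) : route ε ω (1 + hit ε ω.exit) = ω.exit := by
  rw [route_search (by linarith [hit_nonneg ε ω.exit]) (by rw [searchEnd_of_not_grabs hg]),
    add_sub_cancel_left, turn_hit hε ω.norm_exit]

lemma route_eq_of_le {ε : ℝ} {ω ω' : Placement α} {x : ℝ} (h : x ≤ searchEnd ε ω)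
    (h' : x ≤ searchEnd ε ω') {r : ℝ} (hr : r ≤ 1 + x) : route ε ω r = route ε ω' r := by
  rcases le_total r 1 with h1 | h1
  · rw [route_of_le_one h1, route_of_le_one h1]
  · rw [route_search h1 (by linarith), route_search h1 (by linarith)]

/-- Turns the branching condition of `fetchStops` into the hypotheses and conclusion of
`Conveys.fresh` at the time when the branch is taken. -/
lemma fresh_ahead_iff (hα : α ∈ Set.Icc 0 Real.pi) {ε : ℝ} (hε : IsSense ε) {ω : Placement α}
    (hg : ¬ Grabs ε ω) :
    (ω.treasure = ω.exit * turn ε α ∧ IsFirst ε ω) ↔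
      (route ε ω (1 + (hit ε ω.exit + 2 * Real.sin (α / 2))) = ω.treasure ∧
        1 + (hit ε ω.exit + 2 * Real.sin (α / 2)) ≤ 1 + reach ε ω ∧
        1 + (hit ε ω.exit + 2 * Real.sin (α / 2)) ≤ 1 + reach (-ε) ω) := by
  have h1 := sin_half_nonneg hα
  rw [route_ahead hα hε hg (by linarith) le_rfl, ← add_assoc, add_sub_cancel_left,
    ← dist_turn_right hα hε ω.norm_exit, leg_dist, dist_turn_right hα hε ω.norm_exit]
  constructor
  · rintro ⟨hQ, hF⟩
    have hle : hit ε ω.exit ≤ hit ε ω.treasure := not_lt.1 fun h => hg ⟨h, hF⟩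
    rw [IsFirst] at hF
    rw [reach_ahead hle hQ] at hF ⊢
    exact ⟨hQ.symm, by linarith, by linarith⟩
  · rintro ⟨hQ, hi, hj⟩
    refine ⟨hQ.symm, ?_⟩
    have hle : hit ε ω.exit ≤ hit ε ω.treasure := not_lt.1 fun h => by
      rw [reach_of_lt h] at hi; linarith
    rw [IsFirst, reach_ahead hle hQ.symm]
    linarith

lemma fresh_behind_iff (hα : α ∈ Set.Icc 0 Real.pi) {ε : ℝ} (hε : IsSense ε) {ω : Placement α}
    (hg : ¬ Grabs ε ω) (hn : ¬ (ω.treasure = ω.exit * turn ε α ∧ IsFirst ε ω)) :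
    (ω.treasure = ω.exit * turn ε (-α) ∧ IsFirst ε ω) ↔
      (route ε ω (1 + (hit ε ω.exit + 2 * Real.sin (α / 2) + 2 * Real.sin α)) = ω.treasure ∧
        1 + (hit ε ω.exit + 2 * Real.sin (α / 2) + 2 * Real.sin α) ≤ 1 + reach ε ω ∧
        1 + (hit ε ω.exit + 2 * Real.sin (α / 2) + 2 * Real.sin α) ≤ 1 + reach (-ε) ω) := by
  have h1 := sin_half_nonneg hα
  have h2 := sin_nonneg hα
  rw [route_behind hα hε hg hn (by linarith) le_rfl,
    show 1 + (hit ε ω.exit + 2 * Real.sin (α / 2) + 2 * Real.sin α)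
      - (1 + (hit ε ω.exit + 2 * Real.sin (α / 2))) = 2 * Real.sin α by ring,
    ← dist_turn_turn_neg hα hε ω.norm_exit, leg_dist, dist_turn_turn_neg hα hε ω.norm_exit]
  constructor
  · rintro ⟨hP, hF⟩
    have hle : hit ε ω.exit ≤ hit ε ω.treasure := not_lt.1 fun h => hg ⟨h, hF⟩
    have hQ : ω.treasure ≠ ω.exit * turn ε α := fun hQ => hn ⟨hQ, hF⟩
    rw [IsFirst] at hF
    rw [reach_behind hle hQ] at hF ⊢
    exact ⟨hP.symm, by linarith, by linarith⟩
  · rintro ⟨hP, hi, hj⟩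
    refine ⟨hP.symm, ?_⟩
    have hle : hit ε ω.exit ≤ hit ε ω.treasure := not_lt.1 fun h => by
      rw [reach_of_lt h] at hi; linarith
    by_cases hQ : ω.treasure = ω.exit * turn ε α
    · rw [IsFirst, reach_ahead hle hQ]
      linarith
    · rw [IsFirst, reach_behind hle hQ]
      linarith

/-- Agreement is extended stage by stage. Up to the place ahead the stops depend only on the exit;
what is seen there settles the first branch, and what is seen at the place behind settles the
second. -/
lemma route_eq_of_fetch (hα : α ∈ Set.Icc 0 Real.pi) {ε : ℝ} (hε : IsSense ε) {ω ω' : Placement α}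
    (hg : ¬ Grabs ε ω) (hg' : ¬ Grabs ε ω') (hE : ω'.exit = ω.exit) {t : ℝ}
    (H : ∀ s, 0 ≤ s → s < t → (∀ r, 0 ≤ r → r ≤ s → route ε ω r = route ε ω' r) →
      Conveys ε ω ω' s ∧ Conveys ε ω' ω s)
    (ht : 1 + hit ε ω.exit ≤ t) : route ε ω t = route ε ω' t := by
  have h1 := sin_half_nonneg hα
  have h2 := sin_nonneg hα
  have h3 := hit_nonneg ε ω.exit
  have hx := searchEnd_of_not_grabs hg
  have hx' := searchEnd_of_not_grabs hg'
  rw [hE] at hx'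
  have agree : ∀ r, r ≤ 1 + (hit ε ω.exit + 2 * Real.sin (α / 2)) →
      route ε ω r = route ε ω' r := by
    intro r hr
    rcases le_total r (1 + hit ε ω.exit) with h | h
    · exact route_eq_of_le hx.ge hx'.ge h
    · rw [route_ahead hα hε hg h hr, route_ahead hα hε hg' (by rwa [hE]) (by rwa [hE]), hE]
  rcases le_or_gt t (1 + (hit ε ω.exit + 2 * Real.sin (α / 2))) with ht1 | ht1
  · exact agree t ht1
  obtain ⟨hI, hI'⟩ := H _ (by linarith) ht1 fun r _ => agree r
  have key : (ω.treasure = ω.exit * turn ε α ∧ IsFirst ε ω) ↔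
      (ω'.treasure = ω'.exit * turn ε α ∧ IsFirst ε ω') := by
    rw [fresh_ahead_iff hα hε hg, fresh_ahead_iff hα hε hg', hE]
    exact ⟨fun h => hI.fresh h.1 h.2.1 h.2.2, fun h => hI'.fresh h.1 h.2.1 h.2.2⟩
  have finish : fetchStops ε ω = fetchStops ε ω' → route ε ω t = route ε ω' t := fun h => by
    rw [route_fetch hε hg ht, route_fetch hε hg' (by rwa [hE]), h, hE]
  by_cases hQ : ω.treasure = ω.exit * turn ε α ∧ IsFirst ε ω
  · apply finish
    rw [fetchStops, fetchStops, if_pos hQ, if_pos (key.1 hQ), hE]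
  have hQ' := mt key.2 hQ
  have agree' : ∀ r, r ≤ 1 + (hit ε ω.exit + 2 * Real.sin (α / 2) + 2 * Real.sin α) →
      route ε ω r = route ε ω' r := by
    intro r hr
    rcases le_total r (1 + (hit ε ω.exit + 2 * Real.sin (α / 2))) with h | h
    · exact agree r h
    · rw [route_behind hα hε hg hQ h hr, route_behind hα hε hg' hQ' (by rwa [hE]) (by rwa [hE]), hE]
  rcases le_or_gt t (1 + (hit ε ω.exit + 2 * Real.sin (α / 2) + 2 * Real.sin α)) with ht2 | ht2
  · exact agree' t ht2
  obtain ⟨hJ, hJ'⟩ := H _ (by linarith) ht2 fun r _ => agree' r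
  have key' : (ω.treasure = ω.exit * turn ε (-α) ∧ IsFirst ε ω) ↔
      (ω'.treasure = ω'.exit * turn ε (-α) ∧ IsFirst ε ω') := by
    rw [fresh_behind_iff hα hε hg hQ, fresh_behind_iff hα hε hg' hQ', hE]
    exact ⟨fun h => hJ.fresh h.1 h.2.1 h.2.2, fun h => hJ'.fresh h.1 h.2.1 h.2.2⟩
  apply finish
  rw [fetchStops, fetchStops, if_neg hQ, if_neg hQ', hE]
  rw [hE] at key'
  by_cases hP : ω.treasure = ω.exit * turn ε (-α) ∧ IsFirst ε ω
  · rw [if_pos hP, if_pos (key'.1 hP)]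
  · rw [if_neg hP, if_neg (mt key'.2 hP)]

lemma route_carry_first {ε : ℝ} (hε : IsSense ε) {ω : Placement α} (hg : Grabs ε ω) {b : ℂ}
    {l : List ℂ} (hl : carryStops ε ω = b :: l) {t : ℝ} (h : 1 + hit ε ω.treasure ≤ t)
    (h' : t ≤ 1 + hit ε ω.treasure + dist ω.treasure b) :
    route ε ω t = leg ω.treasure b (t - (1 + hit ε ω.treasure)) := by
  rw [route_carry hε hg h, hl, walk_of_le (by linarith)]

lemma route_eq_of_carryStops_eq {ε : ℝ} (hε : IsSense ε) {ω ω' : Placement α} (hg : Grabs ε ω)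
    (hg' : Grabs ε ω') (hT : ω'.treasure = ω.treasure) {t : ℝ} (ht : 1 + hit ε ω.treasure ≤ t)
    (h : carryStops ε ω = carryStops ε ω') : route ε ω t = route ε ω' t := by
  rw [route_carry hε hg ht, route_carry hε hg' (by rwa [hT]), h, hT]

/-- Two robots that carry the treasure and go to the same place take the same way. -/
lemma route_eq_of_carry_first {ε : ℝ} (hε : IsSense ε) {ω ω' : Placement α} (hg : Grabs ε ω)
    (hg' : Grabs ε ω') (hT : ω'.treasure = ω.treasure) {b : ℂ} {l l' : List ℂ}
    (hl : carryStops ε ω = b :: l) (hl' : carryStops ε ω' = b :: l') {t : ℝ}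
    (ht : t ≤ 1 + hit ε ω.treasure + dist ω.treasure b) : route ε ω t = route ε ω' t := by
  have hx := searchEnd_of_grabs hg
  have hx' := searchEnd_of_grabs hg'
  rw [hT] at hx'
  rcases le_total t (1 + hit ε ω.treasure) with h | h
  · exact route_eq_of_le hx.ge hx'.ge h
  · rw [route_carry_first hε hg hl h ht, route_carry_first hε hg' hl' (by rwa [hT]) (by rwa [hT]),
      hT]

lemma exists_carryStops_alone {ε : ℝ} {ω : Placement α} (hA : ¬ KnowsAhead α ε ω.treasure)
    (hG : GoesAlone α ε ω.treasure) :
    ∃ l, carryStops ε ω = ω.treasure * turn ε (-α) :: l := by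
  rw [carryStops, if_neg hA, if_pos hG]; split_ifs <;> exact ⟨_, rfl⟩

lemma exists_carryStops_meet {ε : ℝ} {ω : Placement α} (hA : ¬ KnowsAhead α ε ω.treasure)
    (hG : ¬ GoesAlone α ε ω.treasure) :
    ∃ l, carryStops ε ω = meetPoint α ε ω.treasure :: l := by
  rw [carryStops, if_neg hA, if_neg hG]; split_ifs <;> exact ⟨_, rfl⟩

/-- `KnowsAhead` and `GoesAlone` depend only on `T`, so the carrier makes at most one uncertain
decision. It is settled by detecting the exit at the candidate behind, or by hearing of it at the
meeting point. -/
lemma route_eq_of_carry (hα : α ∈ Set.Icc 0 Real.pi) {ε : ℝ} (hε : IsSense ε) {ω ω' : Placement α}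
    (hg : Grabs ε ω) (hg' : Grabs ε ω') (hT : ω'.treasure = ω.treasure) {t : ℝ}
    (H : ∀ s, 0 ≤ s → s < t → (∀ r, 0 ≤ r → r ≤ s → route ε ω r = route ε ω' r) →
      Conveys ε ω ω' s ∧ Conveys ε ω' ω s)
    (ht : 1 + hit ε ω.treasure ≤ t) : route ε ω t = route ε ω' t := by
  have h3 := hit_nonneg ε ω.treasure
  by_cases hA : KnowsAhead α ε ω.treasure
  · apply route_eq_of_carryStops_eq hε hg hg' hT ht
    rw [carryStops, carryStops, hT, if_pos hA, if_pos hA]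
  have hA' : ¬ KnowsAhead α ε ω'.treasure := by rwa [hT]
  by_cases hG : GoesAlone α ε ω.treasure
  · obtain ⟨l, hl⟩ := exists_carryStops_alone hA hG
    obtain ⟨l', hl'⟩ := exists_carryStops_alone (ω := ω') hA' (by rwa [hT])
    rw [hT] at hl'
    have agree : ∀ r, r ≤ 1 + hit ε ω.treasure + dist ω.treasure (ω.treasure * turn ε (-α)) →
        route ε ω r = route ε ω' r := fun r => route_eq_of_carry_first hε hg hg' hT hl hl'
    have hd0 : 0 ≤ dist ω.treasure (ω.treasure * turn ε (-α)) := dist_nonneg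
    rcases le_or_gt t (1 + hit ε ω.treasure + dist ω.treasure (ω.treasure * turn ε (-α)))
      with h | h
    · exact agree t h
    obtain ⟨hI, hI'⟩ := H _ (by linarith) h fun r _ => agree r
    have hpos := route_carry_first hε hg hl (by linarith) le_rfl
    rw [add_sub_cancel_left, leg_dist] at hpos
    have hpos' := (agree _ le_rfl).symm.trans hpos
    have key : ω.exit = ω.treasure * turn ε (-α) ↔ ω'.exit = ω.treasure * turn ε (-α) :=
      ⟨fun h => ((hI.exit (hpos.trans h.symm)).symm.trans hpos'),
        fun h => ((hI'.exit (hpos'.trans h.symm)).symm.trans hpos)⟩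
    apply route_eq_of_carryStops_eq hε hg hg' hT ht
    rw [carryStops, carryStops, hT]
    simp only [key]
  · have hG' : ¬ GoesAlone α ε ω'.treasure := by rwa [hT]
    obtain ⟨l, hl⟩ := exists_carryStops_meet hA hG
    obtain ⟨l', hl'⟩ := exists_carryStops_meet hA' hG'
    rw [hT] at hl'
    obtain ⟨hd, hK0, hK1⟩ := dist_meetTime_bounds hα hε ω.norm_treasure hA hG
    have hdK : dist ω.treasure (meetPoint α ε ω.treasure) = meetTime α - hit ε ω.treasure :=
      dist_left_leg hK0 (by rwa [hd])
    have agree : ∀ r, r ≤ 1 + meetTime α → route ε ω r = route ε ω' r := fun r hr =>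
      route_eq_of_carry_first hε hg hg' hT hl hl' (by rw [hdK]; linarith)
    rcases le_or_gt t (1 + meetTime α) with h | h
    · exact agree t h
    obtain ⟨hI, hI'⟩ := H _ (by linarith) h fun r _ => agree r
    have hpos := route_carry_first hε hg hl (t := 1 + meetTime α) (by linarith)
      (by rw [hdK]; linarith)
    rw [show 1 + meetTime α - (1 + hit ε ω.treasure)
      = dist ω.treasure (meetPoint α ε ω.treasure) by rw [hdK]; ring, leg_dist] at hpos
    have hpos' := (agree _ le_rfl).symm.trans hpos
    have key : ω.exit = ω.treasure * turn ε (-α) ↔ ω'.exit = ω.treasure * turn ε (-α) := by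
      constructor
      · intro hX
        obtain ⟨hm, r, hr0, hr1, hr⟩ := route_neg_meetTime hα hε hg hA hG hX
        exact (hI.told (hm.trans hpos.symm) r hr0 hr1 hr).trans hX
      · intro hX
        obtain ⟨hm, r, hr0, hr1, hr⟩ := route_neg_meetTime hα hε hg' hA' hG' (by rwa [hT])
        rw [hT] at hm
        exact (hI'.told (hm.trans hpos'.symm) r hr0 hr1 hr).trans hX
    apply route_eq_of_carryStops_eq hε hg hg' hT ht
    rw [carryStops, carryStops, hT]
    simp only [key]

/-- At the earlier end of search the robot sees a fresh treasure or the exit. This forces the same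
event, at the same point, under the other placement, after which the carrying or fetching case
applies. -/
lemma route_eq_of_conveys (hα : α ∈ Set.Icc 0 Real.pi) {ε : ℝ} (hε : IsSense ε)
    {ω ω' : Placement α} {t : ℝ}
    (H : ∀ s, 0 ≤ s → s < t → (∀ r, 0 ≤ r → r ≤ s → route ε ω r = route ε ω' r) →
      Conveys ε ω ω' s ∧ Conveys ε ω' ω s) : route ε ω t = route ε ω' t := by
  wlog hx : searchEnd ε ω ≤ searchEnd ε ω' generalizing ω ω'
  · exact (this (fun s h0 hs h => (H s h0 hs fun r hr hr' => (h r hr hr').symm).symm)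
      (le_of_not_ge hx)).symm
  have agree : ∀ r, r ≤ 1 + searchEnd ε ω → route ε ω r = route ε ω' r := fun r =>
    route_eq_of_le le_rfl hx
  rcases le_or_gt t (1 + searchEnd ε ω) with ht | ht
  · exact agree t ht
  obtain ⟨hI, hI'⟩ := H _ (by linarith [searchEnd_nonneg ε ω]) ht fun r _ => agree r
  have hag := agree _ le_rfl
  have hle' := searchEnd_le ε ω'
  by_cases hg : Grabs ε ω
  · rw [searchEnd_of_grabs hg] at *
    have hpos := route_search_end_of_grabs hε hg
    have hF := hg.2
    rw [IsFirst, reach_of_lt hg.1] at hF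
    obtain ⟨hT, -, hj⟩ := hI.fresh hpos (by rw [reach_of_lt hg.1]) (by linarith)
    have hTT : ω'.treasure = ω.treasure := by rw [← hT, ← hag, hpos]
    -- Equality would put the exit of `ω'` at the treasure's place, where it would be detected under
    -- `ω` too.
    have hlt : hit ε ω'.treasure < hit ε ω'.exit := by
      rw [hTT]
      refine lt_of_le_of_ne (hx.trans hle') fun heq => ?_
      have hE' : ω'.exit = ω.treasure := by
        rw [← turn_hit hε ω'.norm_exit, ← heq, turn_hit hε ω.norm_treasure]
      have := hI'.exit (by rw [← hag, hpos, hE'])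
      rw [hpos] at this
      exact hg.1.ne (congrArg _ this)
    have hg' : Grabs ε ω' := ⟨hlt, by rw [IsFirst, reach_of_lt hlt, hTT]; linarith⟩
    exact route_eq_of_carry hα hε hg hg' hTT H ht.le
  · rw [searchEnd_of_not_grabs hg] at *
    have hpos := route_search_end_of_not_grabs hε hg
    have hE : ω'.exit = ω.exit := by rw [← hI.exit hpos, ← hag, hpos]
    have hg' : ¬ Grabs ε ω' := fun hg' => by
      rw [searchEnd_of_grabs hg', ← hE] at hx
      exact hg'.1.not_ge hx
    exact route_eq_of_fetch hα hε hg hg' hE H ht.le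

end Online

/-! ### The algorithm -/

section Algorithm

variable {α : ℝ}

lemma sameObservation_symm {ω ω' : Placement α} {p p' : Fin 2 → ℝ≥0 → ℂ} {i : Fin 2} {t : ℝ≥0}
    (h : SameObservation ω ω' p p' i t) : SameObservation ω' ω p' p i t :=
  ⟨⟨h.1.1.symm, h.1.2.symm⟩, fun j => ⟨(h.2 j).1.symm, fun hj r hr =>
    have := (h.2 j).2 ((h.2 j).1.2 hj) r hr
    ⟨this.1.symm, this.2.1.symm, this.2.2.symm⟩⟩⟩

/-- A robot can tell whether it is at the hiding place of the treasure at the time of the first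
visit. -/
lemma first_visit_of_sameObservation {ω ω' : Placement α} {p p' : Fin 2 → ℝ≥0 → ℂ} {i : Fin 2}
    {t : ℝ≥0} (h : SameObservation ω ω' p p' i t) (hi : p i t = ω.treasure)
    (hf : ∀ r < t, ∀ j, p j r ≠ ω.treasure) :
    p' i t = ω'.treasure ∧ ∀ r < t, ∀ j, p' j r ≠ ω'.treasure := by
  have hT : TreasureAt ω.treasure p t (p i t) := by
    left
    by_cases h0 : p 0 t = ω.treasure
    · exact ⟨0, ⟨t, le_rfl, h0, hf, fun j hj => absurd hj (Fin.not_lt_zero j)⟩, h0.trans hi.symm⟩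
    · obtain rfl : i = 1 := by
        fin_cases i
        · exact absurd hi h0
        · rfl
      refine ⟨1, ⟨t, le_rfl, hi, hf, fun j hj => ?_⟩, rfl⟩
      obtain rfl : j = 0 := by omega
      exact h0
  -- A carrier present under `ω'` tells its past. Had it picked the treasure up before `t`, its
  -- detection then would recur under `ω`, where no robot has yet visited the treasure.
  rcases h.1.2.1 hT with ⟨j, ⟨s, hs, hjs, hf', hmin⟩, hj⟩ | ⟨hz, hf'⟩
  · have hpast := (h.2 j).2 ((h.2 j).1.2 hj)
    rcases hs.eq_or_lt with rfl | hlt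
    · exact ⟨hj.symm.trans hjs, hf'⟩
    · exfalso
      rcases (hpast s hs).2.2.2 (Or.inl ⟨j, ⟨s, le_rfl, hjs, hf', hmin⟩, rfl⟩) with
        ⟨k, ⟨r, hr, hkr, -⟩, -⟩ | ⟨hz, -⟩
      · exact hf r (hr.trans_lt hlt) k hkr
      · exact hf s hlt j hz
  · exact absurd hz (hf' t le_rfl i)

/-- The senses in which the two robots search the circle. -/
def sense (i : Fin 2) : ℝ := if i = 0 then 1 else -1

lemma isSense_sense (i : Fin 2) : IsSense (sense i) := by
  rw [sense]; split_ifs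
  exacts [Or.inl rfl, Or.inr rfl]

lemma sense_rev (i : Fin 2) : sense i.rev = -sense i := by
  fin_cases i <;> simp [sense]

lemma eq_or_eq_rev (i j : Fin 2) : j = i ∨ j = i.rev := by
  fin_cases i <;> fin_cases j <;> simp

/-- The motion of the two robots. -/
noncomputable def motion (ω : Placement α) (i : Fin 2) (t : ℝ≥0) : ℂ := route (sense i) ω t

lemma motion_rev (ω : Placement α) (i : Fin 2) (t : ℝ≥0) :
    motion ω i.rev t = route (-sense i) ω t := by rw [motion, sense_rev]

lemma first_visit_iff (hα : α ∈ Set.Icc 0 Real.pi) (ω : Placement α) (i : Fin 2) (t : ℝ≥0) :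
    (∀ r < t, ∀ j, motion ω j r ≠ ω.treasure) ↔
      (t : ℝ) ≤ 1 + reach (sense i) ω ∧ (t : ℝ) ≤ 1 + reach (-sense i) ω := by
  constructor
  · intro h
    have key : ∀ j, (t : ℝ) ≤ 1 + reach (sense j) ω := fun j => by
      by_contra! hlt
      exact h ⟨1 + reach (sense j) ω, by linarith [reach_nonneg hα (sense j) ω]⟩ hlt j
        (route_reach hα (isSense_sense j) ω)
    exact ⟨key i, sense_rev i ▸ key i.rev⟩
  · rintro ⟨h, h'⟩ r hr j
    have hr' : (r : ℝ) < t := hr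
    refine route_ne_treasure hα (isSense_sense j) ω r.2 (hr'.trans_le ?_)
    rcases eq_or_eq_rev i j with rfl | rfl
    · exact h
    · rwa [sense_rev]

/-- Only here does the observation model enter: equal observations supply the three facts on which
the routes' decisions depend. -/
lemma conveys_of_sameObservation (hα : α ∈ Set.Icc 0 Real.pi) {ω ω' : Placement α} {i : Fin 2}
    {t : ℝ≥0} (h : SameObservation ω ω' (motion ω) (motion ω') i t) :
    Conveys (sense i) ω ω' t where
  exit := h.1.1.1
  fresh h0 h1 h2 := by
    have := first_visit_of_sameObservation h h0 ((first_visit_iff hα ω i t).2 ⟨h1, h2⟩)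
    exact ⟨this.1, (first_visit_iff hα ω' i t).1 this.2⟩
  told hm r hr0 hr hE := by
    lift r to ℝ≥0 using hr0
    obtain ⟨heq, hdet, -⟩ := (h.2 i.rev).2 (by rw [motion_rev]; exact hm) r (by exact_mod_cast hr)
    have hE' : motion ω i.rev r = ω.exit := by rw [motion_rev]; exact hE
    rw [← hE', heq]
    exact (hdet.1 hE').symm

/-- The algorithm: both robots search the circle in opposite senses and follow their routes. -/
noncomputable def algorithm (hα : α ∈ Set.Icc 0 Real.pi) : F2FAlgorithm α where
  pos := motion
  isTrajectory ω i :=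
    { start := by simp [motion, route_of_le_one]
      mem_disk := fun t => norm_patrol_le (searchEnd_nonneg _ _)
        (norm_le_of_mem_stops hα (isSense_sense i) ω) t.2
      speed := LipschitzWith.of_dist_le_mul fun s t => by
        rw [NNReal.coe_one, one_mul]
        exact dist_patrol_le (isSense_sense i) (searchEnd_nonneg _ _) _ _ _ }
  online ω ω' i t hne := by
    by_contra! H
    refine hne (route_eq_of_conveys hα (isSense_sense i) fun s h0 hs hag => ?_)
    have := H ⟨s, h0⟩ hs fun r hr => hag r r.2 hr
    exact ⟨conveys_of_sameObservation hα this,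
      conveys_of_sameObservation hα (sameObservation_symm this)⟩

/-! ### The evacuation time -/

lemma walk_pair {a b c : ℂ} : walk a [b, c] (dist a b + dist b c) = c := by
  rw [walk_of_ge (by linarith [dist_nonneg (x := b) (y := c)]), add_sub_cancel_left,
    walk_of_le le_rfl, leg_dist]

lemma walk_single {a b : ℂ} : walk a [b] (dist a b) = b := by
  rw [walk_of_le le_rfl, leg_dist]

lemma walk_triple {a b c d : ℂ} :
    walk a [b, c, d] (dist a b + dist b c + dist c d) = d := by
  rw [walk_of_ge (by linarith [dist_nonneg (x := b) (y := c), dist_nonneg (x := c) (y := d)]),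
    add_assoc, add_sub_cancel_left, walk_pair]

/-- A robot that finds the exit first, and then the treasure in place, is back in time. -/
lemma exists_route_eq_exit_of_fetch (hα : α ∈ Set.Icc 0 Real.pi) {ε : ℝ} (hε : IsSense ε)
    {ω : Placement α} (hle : hit ε ω.exit ≤ hit ε ω.treasure) (hF : IsFirst ε ω) :
    ∃ t, 1 + reach ε ω ≤ t ∧ t ≤ 1 + Real.pi - α / 2 + 3 * Real.sin (α / 2) ∧
      route ε ω t = ω.exit := by
  have h1 := sin_half_nonneg hα
  have h1' := Real.sin_le_one (α / 2)
  have h2 := sin_nonneg hα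
  have h3 := hit_nonneg ε ω.exit
  have h4 := hit_lt ε ω.treasure
  have hI := sin_le_pi_sub hα.2
  have hpi := Real.pi_gt_three
  have hα0 := hα.1
  have hαpi := hα.2
  have hg := not_grabs_of_le hle
  have hdQ := dist_turn_right hα hε ω.norm_exit
  have hdP := dist_turn_neg_right hα hε ω.norm_exit
  have hdQP := dist_turn_turn_neg hα hε ω.norm_exit
  rw [IsFirst] at hF
  -- After the pickup only one chord of length `2 sin (α/2)` remains. The bound on the pickup itself
  -- comes from comparison with the other robot's arrival time.
  suffices hB : reach ε ω ≤ Real.pi - α / 2 + Real.sin (α / 2) by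
    by_cases hQ : ω.treasure = ω.exit * turn ε α
    · rw [reach_ahead hle hQ] at hF hB ⊢
      refine ⟨1 + hit ε ω.exit + (2 * Real.sin (α / 2) + 2 * Real.sin (α / 2)), by linarith,
        by linarith, ?_⟩
      rw [route_fetch hε hg (by linarith), add_sub_cancel_left, fetchStops,
        if_pos ⟨hQ, by rw [IsFirst, reach_ahead hle hQ]; exact hF⟩]
      conv_lhs => rw [← hdQ]; arg 3; arg 2; rw [dist_comm]
      exact walk_pair
    · have hP := (treasure_eq ω hε).resolve_left hQ
      rw [reach_behind hle hQ] at hF hB ⊢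
      refine ⟨1 + hit ε ω.exit + (2 * Real.sin (α / 2) + 2 * Real.sin α + 2 * Real.sin (α / 2)),
        by linarith, by linarith, ?_⟩
      rw [route_fetch hε hg (by linarith), add_sub_cancel_left, fetchStops,
        if_neg (fun h => hQ h.1), if_pos ⟨hP, by rw [IsFirst, reach_behind hle hQ]; exact hF⟩]
      have := walk_triple (a := ω.exit) (b := ω.exit * turn ε α) (c := ω.exit * turn ε (-α))
        (d := ω.exit)
      rwa [dist_comm _ ω.exit, hdQ, hdP, hdQP] at this
  by_cases hQ : ω.treasure = ω.exit * turn ε α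
  · rw [reach_ahead hle hQ] at hF ⊢
    rcases h3.eq_or_lt with he | he
    · linarith
    have he' := hit_neg_of_pos hε ω.norm_exit he
    have hy' := hit_neg_of_pos hε ω.norm_treasure (he.trans_le hle)
    rcases hit_ahead hα hε ω.norm_exit hQ with ⟨hy, _⟩ | ⟨hy, _⟩
    -- For `α = 0` the other robot does not meet the treasure strictly before the exit, so its
    -- `reach` is given by a different branch.
    · rcases hα0.eq_or_lt with h0 | h0
      · have hQ' : ω.treasure = ω.exit * turn (-ε) α := by
          rw [hQ, turn_neg, show -α = α by linarith]
        rw [reach_ahead (by linarith) hQ'] at hF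
        linarith [Real.sin_le (x := α / 2) (by linarith)]
      · rw [reach_of_lt (by linarith)] at hF
        linarith
    · linarith
  · have hP := (treasure_eq ω hε).resolve_left hQ
    rw [reach_behind hle hQ] at hF ⊢
    rcases h3.eq_or_lt with he | he
    · have hE0 := hit_neg_of_eq_zero hε ω.norm_exit he.symm
      have hP' : ω.treasure = ω.exit * turn (-ε) α := by rw [hP, turn_neg]
      rw [reach_ahead (by rw [hE0]; exact hit_nonneg _ _) hP', hE0] at hF
      linarith
    have he' := hit_neg_of_pos hε ω.norm_exit he
    have hy' := hit_neg_of_pos hε ω.norm_treasure (he.trans_le hle)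
    rcases hit_behind hα hε ω.norm_exit hP with ⟨hy, _⟩ | ⟨hy, _⟩
    · have h0 : α = 0 := by linarith
      have : ω.treasure = ω.exit * turn ε α := by rw [hP, show -α = α by linarith]
      exact absurd this hQ
    · rw [reach_of_lt (by linarith)] at hF
      linarith

lemma exists_route_eq_exit_of_carryStops {ε : ℝ} (hε : IsSense ε) {ω : Placement α}
    (hg : Grabs ε ω) {d β : ℝ} (hd : 0 ≤ d) (hβ : 1 + hit ε ω.treasure + d ≤ β)
    (h : walk ω.treasure (carryStops ε ω) d = ω.exit) :
    ∃ t, 1 + reach ε ω ≤ t ∧ t ≤ β ∧ route ε ω t = ω.exit := by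
  refine ⟨1 + hit ε ω.treasure + d, by rw [reach_of_lt hg.1]; linarith, hβ, ?_⟩
  rw [route_carry hε hg (by linarith), add_sub_cancel_left, h]

/-- A robot that finds the treasure first, and in place, carries it to the exit in time. -/
lemma exists_route_eq_exit_of_carry (hα : α ∈ Set.Icc 0 Real.pi) {ε : ℝ} (hε : IsSense ε)
    {ω : Placement α} (hg : Grabs ε ω) :
    ∃ t, 1 + reach ε ω ≤ t ∧ t ≤ 1 + Real.pi - α / 2 + 3 * Real.sin (α / 2) ∧
      route ε ω t = ω.exit := by
  have h1 := sin_half_nonneg hα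
  have h2 := sin_nonneg hα
  have hy0 := hit_nonneg ε ω.treasure
  have hI := sin_le_pi_sub hα.2
  have hI2 := add_sin_add_abs_sin_le hα.1 hα.2
  have hI3 := two_mul_sin_le hα.1 hα.2
  have hα0 := hα.1
  have hαpi := hα.2
  have hmt : meetTime α = α / 2 + Real.sin (α / 2) + Real.sin α := rfl
  have hdW := dist_turn_right hα hε ω.norm_treasure
  have hdX := dist_turn_neg_right hα hε ω.norm_treasure
  have hdXW := dist_turn_turn_neg hα hε ω.norm_treasure
  have he0 : 0 < hit ε ω.exit := hy0.trans_lt hg.1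
  have he' := hit_neg_of_pos hε ω.norm_exit he0
  have hF := hg.2
  rw [IsFirst, reach_of_lt hg.1] at hF
  -- the time to the exit by way of the meeting point
  have meet : ¬ KnowsAhead α ε ω.treasure → ¬ GoesAlone α ε ω.treasure → ∀ z, ∀ c,
      dist ω.treasure z ≤ c → dist (ω.treasure * turn ε (-(2 * α))) z ≤ c →
      dist ω.treasure (meetPoint α ε ω.treasure) + dist (meetPoint α ε ω.treasure) z
        ≤ meetTime α - hit ε ω.treasure + c := by
    intro hA hG z c hc hc'
    obtain ⟨hd, hK0, hK1⟩ := dist_meetTime_bounds hα hε ω.norm_treasure hA hG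
    rw [meetPoint, dist_left_leg hK0 (by rwa [hd])]
    have := (dist_leg_le_max ω.treasure _ z hK0 (by rwa [hd])).trans (max_le hc hc')
    linarith
  by_cases hX : ω.exit = ω.treasure * turn ε (-α)
  · -- the exit is behind
    have hb := hit_behind hα hε ω.norm_treasure hX
    have hyα : hit ε ω.treasure < α := by
      rcases hb with h | h
      · linarith [hg.1]
      · exact h.2
    have he : hit ε ω.exit = hit ε ω.treasure - α + 2 * Real.pi := by
      rcases hb with h | h
      · linarith [hg.1]
      · exact h.1
    -- With the exit behind, being first means that `y` is at most the other robot's arrival time,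
    -- hence at most their mean `meetTime α` when that robot needs both chords, and less when it
    -- needs one.
    have hA : ¬ KnowsAhead α ε ω.treasure := by
      rw [KnowsAhead, not_or, not_le, not_lt]
      refine ⟨hyα, ?_⟩
      rcases hy0.eq_or_lt with h | h
      · rw [← h]; linarith
      have hy' := hit_neg_of_pos hε ω.norm_treasure h
      by_cases hQ : ω.treasure = ω.exit * turn (-ε) α
      · rw [reach_ahead (by linarith) hQ] at hF; linarith
      · rw [reach_behind (by linarith) hQ] at hF; linarith
    have hA' := hA
    rw [KnowsAhead, not_or, not_le, not_lt] at hA'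
    by_cases hG : GoesAlone α ε ω.treasure
    · refine exists_route_eq_exit_of_carryStops hε hg (d := 2 * Real.sin (α / 2)) (by linarith)
        (by linarith) ?_
      rw [carryStops, if_neg hA, if_pos hG, if_pos hX, ← hdX, walk_single, hX]
    · have hm := meet hA hG (ω.treasure * turn ε (-α)) (2 * Real.sin (α / 2)) hdX.le (by
        rw [dist_mul_turn hε ω.norm_treasure,
          show (-(2 * α) - -α) / 2 = -(α / 2) by ring, Real.sin_neg, abs_neg, abs_of_nonneg h1])
      refine exists_route_eq_exit_of_carryStops hε hg (d := dist ω.treasure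
        (meetPoint α ε ω.treasure) + dist (meetPoint α ε ω.treasure) (ω.treasure * turn ε (-α)))
        (by positivity) ?_ (by rw [carryStops, if_neg hA, if_neg hG, if_pos hX, walk_pair, hX])
      linarith
  · -- the exit is ahead
    have hW : ω.exit = ω.treasure * turn ε α := by
      rcases treasure_eq ω hε with h | h
      · exact absurd (by rw [h, mul_assoc, turn_mul_turn_neg, mul_one]) hX
      · rw [h, mul_assoc, mul_comm (turn ε (-α)), turn_mul_turn_neg, mul_one]
    have he : hit ε ω.exit = hit ε ω.treasure + α := by
      rcases hit_ahead hα hε ω.norm_treasure hW with h | h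
      · exact h.1
      · linarith [hg.1, hit_lt ε ω.treasure, h.1]
    -- For the other robot the treasure is at the place ahead of the exit, the first one it would
    -- visit; being first gives `y ≤ 2π - y - α + 2 sin (α/2)`.
    have hyB : hit ε ω.treasure ≤ Real.pi - α / 2 + Real.sin (α / 2) := by
      rcases hy0.eq_or_lt with h | h
      · linarith
      have hy' := hit_neg_of_pos hε ω.norm_treasure h
      have hQ : ω.treasure = ω.exit * turn (-ε) α := by
        rw [hW, turn_neg, mul_assoc, turn_mul_turn_neg, mul_one]
      rw [reach_ahead (by linarith) hQ] at hF
      linarith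
    by_cases hA : KnowsAhead α ε ω.treasure
    · refine exists_route_eq_exit_of_carryStops hε hg (d := 2 * Real.sin (α / 2)) (by linarith)
        (by linarith) ?_
      rw [carryStops, if_pos hA, ← hdW, walk_single, hW]
    by_cases hG : GoesAlone α ε ω.treasure
    · refine exists_route_eq_exit_of_carryStops hε hg
        (d := 2 * Real.sin (α / 2) + 2 * Real.sin α) (by linarith) ?_ ?_
      -- For `y = 0` this is `two_mul_sin_le`; otherwise `y + 2 sin α < meetTime α` and `sin α ≤ π -
      -- α`.
      · rcases hG with h | h <;> linarith
      · rw [carryStops, if_neg hA, if_pos hG, if_neg hX, ← hdX, ← hdXW,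
          dist_comm (ω.treasure * turn ε α), walk_pair, hW]
    · have h3 := dist_mul_turn hε ω.norm_treasure (-(2 * α)) α
      rw [show (-(2 * α) - α) / 2 = -(3 * (α / 2)) by ring, Real.sin_neg, abs_neg] at h3
      have hm := meet hA hG (ω.treasure * turn ε α)
        (max (2 * Real.sin (α / 2)) (2 * |Real.sin (3 * (α / 2))|))
        (hdW.le.trans (le_max_left _ _)) (h3.le.trans (le_max_right _ _))
      refine exists_route_eq_exit_of_carryStops hε hg (d := dist ω.treasure
        (meetPoint α ε ω.treasure) + dist (meetPoint α ε ω.treasure) (ω.treasure * turn ε α))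
        (by positivity) ?_ (by rw [carryStops, if_neg hA, if_neg hG, if_neg hX, walk_pair, hW])
      have : max (2 * Real.sin (α / 2)) (2 * |Real.sin (3 * (α / 2))|)
          ≤ Real.pi - α + 2 * Real.sin (α / 2) - Real.sin α :=
        max_le (by linarith) (by linarith)
      linarith

lemma exists_route_eq_exit (hα : α ∈ Set.Icc 0 Real.pi) {ε : ℝ} (hε : IsSense ε)
    {ω : Placement α} (hF : IsFirst ε ω) :
    ∃ t, 1 + reach ε ω ≤ t ∧ t ≤ 1 + Real.pi - α / 2 + 3 * Real.sin (α / 2) ∧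
      route ε ω t = ω.exit := by
  rcases lt_or_ge (hit ε ω.treasure) (hit ε ω.exit) with h | h
  · exact exists_route_eq_exit_of_carry hα hε ⟨h, hF⟩
  · exact exists_route_eq_exit_of_fetch hα hε h hF

lemma holds_motion (hα : α ∈ Set.Icc 0 Real.pi) {ω : Placement α} {i : Fin 2}
    (hF : IsFirst (sense i) ω) (hmin : ∀ j < i, reach (sense i) ω < reach (sense j) ω) {t : ℝ≥0}
    (ht : 1 + reach (sense i) ω ≤ t) : Holds ω.treasure (motion ω) i t := by
  have h0 := reach_nonneg hα (sense i) ω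
  obtain ⟨u, hu⟩ : ∃ u : ℝ≥0, (u : ℝ) = 1 + reach (sense i) ω :=
    ⟨⟨1 + reach (sense i) ω, by linarith⟩, rfl⟩
  refine ⟨u, by rwa [← hu, NNReal.coe_le_coe] at ht, ?_, ?_, ?_⟩
  · rw [motion, hu, route_reach hα (isSense_sense i)]
  · rw [first_visit_iff hα ω i, hu]
    rw [IsFirst] at hF
    exact ⟨le_rfl, by linarith⟩
  · intro j hj
    exact route_ne_treasure hα (isSense_sense j) ω u.2 (hu.trans_lt (by linarith [hmin j hj]))

lemma algorithm_evacuatesBy (hα : α ∈ Set.Icc 0 Real.pi) (ω : Placement α) :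
    (algorithm hα).EvacuatesBy ω (1 + Real.pi - α / 2 + 3 * Real.sin (α / 2)) := by
  -- In a tie both robots satisfy `IsFirst`; robot `0` is chosen, as `Holds` prescribes.
  have h : ∃ i : Fin 2, IsFirst (sense i) ω ∧
      ∀ j < i, reach (sense i) ω < reach (sense j) ω := by
    by_cases h0 : IsFirst (sense 0) ω
    · exact ⟨0, h0, fun j hj => absurd hj (Fin.not_lt_zero j)⟩
    · have h1 : sense 1 = -sense 0 := by simp [sense]
      rw [IsFirst, not_le] at h0
      refine ⟨1, ?_, fun j hj => ?_⟩
      · rw [IsFirst, h1, neg_neg]; exact h0.le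
      · obtain rfl : j = 0 := by omega
        rwa [h1]
  obtain ⟨i, hF, hmin⟩ := h
  obtain ⟨t, ht, hβ, hE⟩ := exists_route_eq_exit hα (isSense_sense i) hF
  exact ⟨⟨t, by linarith [reach_nonneg hα (sense i) ω]⟩, hβ, i, holds_motion hα hF hmin ht, hE⟩

end Algorithm

end TreasureHunt

theorem mainTheorem1 (α : ℝ) (hα : α ∈ Set.Icc 0 Real.pi) :
    SolvableF2F α (1 + Real.pi - α / 2 + 3 * Real.sin (α / 2)) :=
  ⟨TreasureHunt.algorithm hα, TreasureHunt.algorithm_evacuatesBy hα⟩
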